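/- Let $q,\kappa_1,\kappa_2,\theta_1,\theta_2$ be nonzero complex numbers and $c_1,\dots,c_4\in\mathbf C$ with $\kappa_1\kappa_2c_1c_2c_3c_4=\theta_1\theta_2$, and assume $c_1\ne c_2$, $c_3\ne c_4$, $\theta_1\ne\theta_2$, $q\theta_1\ne\theta_2$, $q\kappa_1\ne\kappa_2$, $q^2\kappa_1\ne\kappa_2$. (The parameters $c_1,\dots,c_4$ and $q$ stay fixed.) Let $Y_{\kappa_1,\kappa_2,\theta_1,\theta_2}$ be the surface obtained from $\mathbf P^1\times\mathbf P^1$, with coordinates $(y,\xi)$, by blowing up the eight points $$(c_1,0),\ (c_2,0),\ (c_3,\infty),\ (c_4,\infty),\ (0,c_1c_2/\theta_1),\ (0,c_1c_2/\theta_2),\ (\infty,1/\kappa_1),\ (\infty,q/\kappa_2)$$ and removing the strict transforms of the four lines $y=0$, $y=\infty$, $\xi=0$, $\xi=\infty$. A polynomial matrix $$A(z)=\begin{pmatrix}\kappa_1z^2+az+\theta_1&z-y\\ z(\gamma z+\beta)&\kappa_2z^2+bz+\theta_2\end{pmatrix},\qquad \det A(z)=\kappa_1\kappa_2\prod_{i=1}^4(z-c_i),$$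 with $a,b,\beta,\gamma\in\mathbf C$, is said to have Jimbo–Sakai coordinates $(y,\xi)\in\mathbf C^*\times\mathbf C^*$, for the parameters $(\kappa_1,\kappa_2,\theta_1,\theta_2)$, if $\xi A_{11}(y)=(y-c_1)(y-c_2)$ and $A_{22}(y)=\kappa_1\kappa_2\,\xi\,(y-c_3)(y-c_4)$. Let $\phi:(y,\xi)\mapsto(\tilde y,\tilde\xi)$ be the birational map characterized, for generic $(y,\xi)$, as follows: if $A(z)$ has coordinates $(y,\xi)$ for the parameters $(\kappa_1,\kappa_2,\theta_1,\theta_2)$, then the polynomial matrix $$\hat A(z)=\begin{pmatrix}qz&0\\0&1\end{pmatrix}A(z)\begin{pmatrix}z^{-1}&0\\0&1\end{pmatrix}$$ is conjugate, by a constant invertible matrix, to a matrix with coordinates $(\tilde y,\tilde\xi)$ for the parameters $(q\kappa_1,\kappa_2,q\theta_1,\theta_2)$. Then $\phi$ extends to a regular isomorphism $Y_{\kappa_1,\kappa_2,\theta_1,\theta_2}\to Y_{q\kappa_1,\kappa_2,q\theta_1,\theta_2}$: there is an isomorphism of algebraic varieties between these surfaces that coincides with $\phi$ on a nonempty Zariski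 open set of points $(y,\xi)\in\mathbf C^*\times\mathbf C^*$. -/

import Mathlib

open scoped Polynomial OnePoint LinearAlgebra.Projectivization

noncomputable section

/-! ### The projective line, `ℙ¹ × ℙ¹`, and affine charts -/

/-- The complex projective line `ℂ ∪ {∞}`. -/
abbrev ProjLine : Type := OnePoint ℂ

/-- The affine plane `ℂ²`, with coordinates indexed by `Fin 2`. -/
abbrev Plane : Type := Fin 2 → ℂ

/-- The standard affine chart of the projective line centred at `a`: it is `t ↦ a + t` if `a` is
finite, and `t ↦ 1 / t` (with `0 ↦ ∞`) if `a = ∞`. -/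
def ProjLine.chartAt (a : ProjLine) (t : ℂ) : ProjLine :=
  OnePoint.elim a (if t = 0 then ∞ else OnePoint.some t⁻¹) (fun s => OnePoint.some (s + t))

/-- The affine chart `ℂ² → ℙ¹ × ℙ¹` centred at `z`; it sends the origin to `z`. -/
def quadricChart (z : ProjLine × ProjLine) (p : Plane) : ProjLine × ProjLine :=
  (ProjLine.chartAt z.1 (p 0), ProjLine.chartAt z.2 (p 1))

/-! ### Zariski open subsets of the plane -/

/-- `U` is a relatively Zariski open subset of `D ⊆ ℂ²`: around each of its points it contains a
basic open set `{G ≠ 0}` of `D`. -/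
def IsZariskiOpenIn (D : Set Plane) (U : Set D) : Prop :=
  ∀ p ∈ U, ∃ G : MvPolynomial (Fin 2) ℂ, MvPolynomial.eval (p : Plane) G ≠ 0 ∧
    ∀ x : D, MvPolynomial.eval (x : Plane) G ≠ 0 → x ∈ U

/-- `U` is a Zariski open subset of `ℂ²`. -/
def IsZariskiOpen (U : Set Plane) : Prop :=
  ∀ p ∈ U, ∃ G : MvPolynomial (Fin 2) ℂ, MvPolynomial.eval p G ≠ 0 ∧
    ∀ x : Plane, MvPolynomial.eval x G ≠ 0 → x ∈ U

/-! ### The blow-up of `ℙ¹ × ℙ¹` along a finite set of points -/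

/-- The set of points of the blow-up of `ℙ¹ × ℙ¹` along a (finite) set `Z` of points: a point
`base` of `ℙ¹ × ℙ¹` together with, if `base ∈ Z`, a tangent direction at `base`.  Directions at
`z ∈ Z` are written in the affine chart `quadricChart z`. The map `base` is the blow-down map. -/
structure BlowUp (Z : Set (ProjLine × ProjLine)) where
  base : ProjLine × ProjLine
  dir : base ∈ Z → ℙ ℂ (Fin 2 → ℂ)

namespace BlowUp

variable {Z : Set (ProjLine × ProjLine)}

lemma update_one_ne_zero (p : Plane) (j : Fin 2) : Function.update p j 1 ≠ 0 := by
  intro h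
  have := congrFun h j
  simp at this

/-- The quadratic map `(u, v) ↦ (u, u v)` (for `j = 0`), `(u, v) ↦ (u v, v)` (for `j = 1`), i.e.
the blow-down map in an affine chart of the blow-up of the origin of the plane. The exceptional
curve is `p j = 0`, and the point `p` lies over the direction `Function.update p j 1`, that is
`[1 : v]` (for `j = 0`), `[u : 1]` (for `j = 1`). -/
def quadraticMap (j : Fin 2) (p : Plane) : Plane := p j • Function.update p j 1

variable (Z) in
/-- Labels for the affine charts covering the blow-up: the charts of `ℙ¹ × ℙ¹` with the centres
removed, and, over each centre, the two charts of the blow-up of the plane at the origin (with the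
other centres removed). -/
inductive Chart : Type
  | away (x : ProjLine × ProjLine) : Chart
  | over (z : ProjLine × ProjLine) (hz : z ∈ Z) (j : Fin 2) : Chart

/-- The domain of a chart, a subset of the affine plane. -/
def Chart.dom : Chart Z → Set Plane
  | .away x => {p | quadricChart x p ∉ Z}
  | .over z _ j => {p | p j = 0 ∨ quadricChart z (quadraticMap j p) ∉ Z}

/-- The parametrization of a part of the blow-up given by a chart. -/
def Chart.toPoint : (i : Chart Z) → i.dom → BlowUp Z
  | .away x, p => ⟨quadricChart x p, fun h => absurd h p.2⟩
  | .over z _ j, p =>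
      ⟨quadricChart z (quadraticMap j p),
        fun _ => Projectivization.mk ℂ (Function.update (p : Plane) j 1) (update_one_ne_zero p j)⟩

/-- The Zariski topology of the blow-up: a set is open if it is Zariski open in each chart. -/
instance : TopologicalSpace (BlowUp Z) where
  IsOpen U := ∀ i : Chart Z, IsZariskiOpenIn i.dom (i.toPoint ⁻¹' U)
  isOpen_univ := fun _ _ _ => ⟨1, by simp, fun _ _ => trivial⟩
  isOpen_inter := by
    intro s t hs ht i p hp
    obtain ⟨G, hG, hG'⟩ := hs i p hp.1
    obtain ⟨H, hH, hH'⟩ := ht i p hp.2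
    refine ⟨G * H, by simp [hG, hH], fun x hx => ?_⟩
    simp only [map_mul, ne_eq, mul_eq_zero, not_or] at hx
    exact ⟨hG' x hx.1, hH' x hx.2⟩
  isOpen_sUnion := by
    intro S hS i p hp
    obtain ⟨U, hU, hpU⟩ := hp
    obtain ⟨G, hG, hG'⟩ := hS U hU i p hpU
    exact ⟨G, hG, fun x hx => ⟨U, hU, hG' x hx⟩⟩

/-- A function on an open subset `U` of the blow-up is regular if, in each chart, it is locally a
quotient of two polynomials. -/
def IsRegularFun {U : Set (BlowUp Z)} (f : U → ℂ) : Prop :=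
  ∀ (i : Chart Z) (p : i.dom), i.toPoint p ∈ U →
    ∃ F G : MvPolynomial (Fin 2) ℂ, MvPolynomial.eval (p : Plane) G ≠ 0 ∧
      ∀ (x : i.dom) (hx : i.toPoint x ∈ U), MvPolynomial.eval (x : Plane) G ≠ 0 →
        f ⟨i.toPoint x, hx⟩ =
          MvPolynomial.eval (x : Plane) F / MvPolynomial.eval (x : Plane) G

/-- A map between open subsets of two blow-ups is regular (a morphism of varieties) if it is
continuous for the Zariski topology and pulls back regular functions to regular functions. -/
def IsRegularMap {Z' : Set (ProjLine × ProjLine)} {U : Set (BlowUp Z)} {V : Set (BlowUp Z')}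
    (f : U → V) : Prop :=
  Continuous f ∧
    ∀ W : Set (BlowUp Z'), IsOpen W → W ⊆ V → ∀ g : W → ℂ, IsRegularFun g →
      IsRegularFun (U := {x | ∃ hx : x ∈ U, (f ⟨x, hx⟩ : BlowUp Z') ∈ W})
        (fun x => g ⟨f ⟨x, x.2.1⟩, x.2.2⟩)

variable (Z) in
/-- The strict transform of a curve `L` in `ℙ¹ × ℙ¹`: the Zariski closure of the inverse image of
`L` with the centres removed. -/
def strictTransform (L : Set (ProjLine × ProjLine)) : Set (BlowUp Z) :=
  closure (base ⁻¹' (L \ Z))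

end BlowUp

/-! ### The surfaces `Y` -/

/-- The complex parameters. -/
structure Params where
  κ₁ : ℂ
  κ₂ : ℂ
  θ₁ : ℂ
  θ₂ : ℂ
  c₁ : ℂ
  c₂ : ℂ
  c₃ : ℂ
  c₄ : ℂ

/-- The parameters `(q κ₁, κ₂, q θ₁, θ₂)`, with the same `cᵢ`. -/
def Params.shift (P : Params) (q : ℂ) : Params :=
  { P with κ₁ := q * P.κ₁, θ₁ := q * P.θ₁ }

/-- The eight points of `ℙ¹ × ℙ¹`, with coordinates `(y, ξ)`, that are blown up. -/
def Params.centres (P : Params) (q : ℂ) : Set (ProjLine × ProjLine) :=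
  {(.some P.c₁, .some 0), (.some P.c₂, .some 0), (.some P.c₃, ∞), (.some P.c₄, ∞),
   (.some 0, .some (P.c₁ * P.c₂ / P.θ₁)), (.some 0, .some (P.c₁ * P.c₂ / P.θ₂)),
   (∞, .some (1 / P.κ₁)), (∞, .some (q / P.κ₂))}

/-- The surface `Y`: the blow-up of `ℙ¹ × ℙ¹` at the eight points, minus the strict transforms of
the four lines `y = 0`, `y = ∞`, `ξ = 0`, `ξ = ∞`. -/
def Params.surface (P : Params) (q : ℂ) : Set (BlowUp (P.centres q)) :=
  (BlowUp.strictTransform (P.centres q) {x | x.1 = .some 0} ∪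
    BlowUp.strictTransform (P.centres q) {x | x.1 = ∞} ∪
    BlowUp.strictTransform (P.centres q) {x | x.2 = .some 0} ∪
    BlowUp.strictTransform (P.centres q) {x | x.2 = ∞})ᶜ

/-! ### The Jimbo–Sakai parametrization and the map `φ` -/

/-- The polynomial matrix `A(z)`, with `det A(z) = κ₁ κ₂ ∏ (z - cᵢ)`, is in Jimbo–Sakai normal form
and has Jimbo–Sakai coordinates `(y, ξ) ∈ ℂ* × ℂ*`.  Here `κ₁ z₁ = A₁₁(y)`, `κ₂ z₂ = A₂₂(y)`, and
`ξ = (y - c₁)(y - c₂) / (κ₁ z₁) = κ₂ z₂ / (κ₁ κ₂ (y - c₃)(y - c₄))`. -/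
structure IsJimboSakai (P : Params) (A : Matrix (Fin 2) (Fin 2) ℂ[X]) (y ξ : ℂ) : Prop where
  y_ne_zero : y ≠ 0
  ξ_ne_zero : ξ ≠ 0
  normal_form : ∃ a b β γ : ℂ, A =
    !![.C P.κ₁ * .X ^ 2 + .C a * .X + .C P.θ₁, .X - .C y;
       .X * (.C γ * .X + .C β), .C P.κ₂ * .X ^ 2 + .C b * .X + .C P.θ₂]
  det_eq : A.det = .C (P.κ₁ * P.κ₂) *
    ((.X - .C P.c₁) * (.X - .C P.c₂) * (.X - .C P.c₃) * (.X - .C P.c₄))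
  ξ_eq₁ : (A 0 0).eval y * ξ = (y - P.c₁) * (y - P.c₂)
  ξ_eq₂ : (A 1 1).eval y = P.κ₁ * P.κ₂ * ξ * ((y - P.c₃) * (y - P.c₄))

/-- The map `φ` in Jimbo–Sakai coordinates, as a relation: if `A(z)` has coordinates `p = (y, ξ)`
for the parameters `P`, and `Â(z) = diag(q z, 1) A(z) diag(z⁻¹, 1)`, then `φ(p) = p'` means that
`Â(z)` is conjugate, by a constant invertible matrix, to a matrix with coordinates `p'` for the
shifted parameters. -/
def IsPhi (P : Params) (q : ℂ) (p p' : Plane) : Prop :=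
  ∃ (A Ahat : Matrix (Fin 2) (Fin 2) ℂ[X]) (B : (Matrix (Fin 2) (Fin 2) ℂ)ˣ),
    IsJimboSakai P A (p 0) (p 1) ∧
    Ahat * !![.X, 0; 0, 1] = !![.C q * .X, 0; 0, 1] * A ∧
    IsJimboSakai (P.shift q)
      ((B : Matrix (Fin 2) (Fin 2) ℂ).map Polynomial.C * Ahat *
        ((B⁻¹ : (Matrix (Fin 2) (Fin 2) ℂ)ˣ) : Matrix (Fin 2) (Fin 2) ℂ).map Polynomial.C)
      (p' 0) (p' 1)

/-- The map `f` between the surfaces extends the birational map `φ`: on a nonempty Zariski open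
(hence dense) set of points `(y, ξ)`, identified with points of the surface, `f` is `φ`. -/
def ExtendsPhi (P : Params) (q : ℂ) (f : P.surface q → (P.shift q).surface q) : Prop :=
  ∃ W : Set Plane, IsZariskiOpen W ∧ W.Nonempty ∧
    ∀ p ∈ W, ∃ p' : Plane, IsPhi P q p p' ∧
      ∃ x : P.surface q,
        (x : BlowUp (P.centres q)).base = (.some (p 0), .some (p 1)) ∧
        (f x : BlowUp ((P.shift q).centres q)).base = (.some (p' 0), .some (p' 1))

end

/-! The proof has two independent halves, joined by explicit formulas. Write b₅ = c₁c₂/θ₁, b₆ =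
c₁c₂/θ₂, b₇ = 1/κ₁, b₈ = q/κ₂. In these terms φ is (y, ξ) ↦ (y', ξ') with an intermediate value η,
as recorded in `TranslationRel`: first η from (y, ξ), then ξ' from (η, ξ), then y' from (η, ξ').

Geometry. The map given by these formulas is a product of simple transformations, each of which is
an isomorphism between surfaces obtained from ℙ¹ × ℙ¹ by blowing up two points on each of the four
lines: inversions y ↦ μ/y (`ModelIso.inv`), elementary transformations y ↦ y(ξ - α)/(ξ - β)
(`ModelIso.elem`), the same with y and ξ exchanged, and changes of the order of blowing up
(`ModelIso.swap`). An elementary transformation blows up (0, β) and (∞, α) and contracts the strict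
transforms of the fibres ξ = β and ξ = α. Following the eight centres through the product
(`exists_modelIso`) gives exactly those of the shifted surface, thanks to κ₁κ₂c₁c₂c₃c₄ = θ₁θ₂.

The hypotheses separate the centres only on the first and the last surface; in between two centres
on a line may collide. A `Model` therefore allows infinitely near centres. Regularity is tested at
each point of each chart (`Lifts`, `Reg`), so intermediate surfaces never have to be glued, and
composition is formal. On the end surfaces the centres are distinct, the charts become charts of the
actual blow-up, and density with separatedness turns the local lifts into an isomorphism
(`ModelIso.exists_equiv`).

Algebra. A matrix with given coordinates (y, ξ) is written down in `isJimboSakai_of_coord`. The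
matrix bringing Â back to normal form has columns that are an eigenvector of Â(0) and one of the
leading coefficient of Â (`isPhi_of_diag_eq`). The new diagonal entries at y' are computed by
viewing y and η as the two roots of one quadratic polynomial (`TranslationRel.diag_eq`). This
identifies φ with the geometric map off a curve (`eventually_isPhi`). -/

open Filter

/-! ### The Zariski topology of the plane -/

/-- The filter of Zariski neighbourhoods of `p`. -/
def zNhds (p : Plane) : Filter Plane where
  sets := {s | ∃ G : MvPolynomial (Fin 2) ℂ, MvPolynomial.eval p G ≠ 0 ∧
    ∀ x, MvPolynomial.eval x G ≠ 0 → x ∈ s}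
  univ_sets := ⟨1, by simp, fun _ _ => trivial⟩
  sets_of_superset := fun ⟨G, hG, h⟩ hst => ⟨G, hG, fun x hx => hst (h x hx)⟩
  inter_sets := fun ⟨G, hG, h⟩ ⟨H, hH, h'⟩ => ⟨G * H, by simp [hG, hH], fun x hx => by
    rw [map_mul, mul_ne_zero_iff] at hx
    exact ⟨h x hx.1, h' x hx.2⟩⟩

/-- The filter of sets containing a nonempty Zariski open set. -/
def zGen : Filter Plane where
  sets := {s | ∃ G : MvPolynomial (Fin 2) ℂ, G ≠ 0 ∧ ∀ x, MvPolynomial.eval x G ≠ 0 → x ∈ s}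
  univ_sets := ⟨1, by simp, fun _ _ => trivial⟩
  sets_of_superset := fun ⟨G, hG, h⟩ hst => ⟨G, hG, fun x hx => hst (h x hx)⟩
  inter_sets := fun ⟨G, hG, h⟩ ⟨H, hH, h'⟩ => ⟨G * H, mul_ne_zero hG hH, fun x hx => by
    rw [map_mul, mul_ne_zero_iff] at hx
    exact ⟨h x hx.1, h' x hx.2⟩⟩

lemma mem_zNhds {p : Plane} {s : Set Plane} :
    s ∈ zNhds p ↔ ∃ G : MvPolynomial (Fin 2) ℂ, MvPolynomial.eval p G ≠ 0 ∧
      ∀ x, MvPolynomial.eval x G ≠ 0 → x ∈ s := Iff.rfl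

lemma mem_zGen {s : Set Plane} :
    s ∈ zGen ↔ ∃ G : MvPolynomial (Fin 2) ℂ, G ≠ 0 ∧
      ∀ x, MvPolynomial.eval x G ≠ 0 → x ∈ s := Iff.rfl

lemma zGen_le_zNhds (p : Plane) : zGen ≤ zNhds p := by
  rintro s ⟨G, hG, h⟩
  exact ⟨G, by rintro rfl; simp at hG, h⟩

/-- A polynomial vanishing at every point of ℂ² is zero. This is the source of all density arguments
below: generic identities are extracted by picking a single point. -/
instance : zGen.NeBot := by
  rw [neBot_iff, Ne, ← empty_mem_iff_bot]
  rintro ⟨G, hG, h⟩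
  exact hG (MvPolynomial.funext fun x => by by_contra hx; exact h x (by simpa using hx))

lemma mem_of_mem_zNhds {p : Plane} {s : Set Plane} (h : s ∈ zNhds p) : p ∈ s := by
  obtain ⟨G, hG, h⟩ := h
  exact h p hG

/-- The function `f` is rational, and regular at `p`. -/
def RatAt (f : Plane → ℂ) (p : Plane) : Prop :=
  ∃ F G : MvPolynomial (Fin 2) ℂ, MvPolynomial.eval p G ≠ 0 ∧
    ∀ x, MvPolynomial.eval x G ≠ 0 → f x = MvPolynomial.eval x F / MvPolynomial.eval x G

/-- The map `g` is rational, and regular at `p`. -/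
def RatMapAt (g : Plane → Plane) (p : Plane) : Prop := ∀ k, RatAt (fun x => g x k) p

namespace RatAt

variable {f g : Plane → ℂ} {p : Plane}

lemma eval (F : MvPolynomial (Fin 2) ℂ) : RatAt (fun x => MvPolynomial.eval x F) p :=
  ⟨F, 1, by simp, by simp⟩

lemma const (c : ℂ) : RatAt (fun _ => c) p := by
  simpa using RatAt.eval (p := p) (MvPolynomial.C c)

lemma coord (i : Fin 2) : RatAt (fun x => x i) p := by
  simpa using RatAt.eval (p := p) (MvPolynomial.X i)

lemma add (hf : RatAt f p) (hg : RatAt g p) : RatAt (fun x => f x + g x) p := by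
  obtain ⟨F, G, hG, h⟩ := hf
  obtain ⟨F', G', hG', h'⟩ := hg
  refine ⟨F * G' + F' * G, G * G', by simp [hG, hG'], fun x hx => ?_⟩
  rw [map_mul, mul_ne_zero_iff] at hx
  have h1 := hx.1
  have h2 := hx.2
  simp only [h x hx.1, h' x hx.2, map_add, map_mul]
  field_simp

lemma mul (hf : RatAt f p) (hg : RatAt g p) : RatAt (fun x => f x * g x) p := by
  obtain ⟨F, G, hG, h⟩ := hf
  obtain ⟨F', G', hG', h'⟩ := hg
  refine ⟨F * F', G * G', by simp [hG, hG'], fun x hx => ?_⟩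
  rw [map_mul, mul_ne_zero_iff] at hx
  have h1 := hx.1
  have h2 := hx.2
  simp only [h x hx.1, h' x hx.2, map_mul]
  field_simp

lemma inv (hf : RatAt f p) (h0 : f p ≠ 0) : RatAt (fun x => (f x)⁻¹) p := by
  obtain ⟨F, G, hG, h⟩ := hf
  have hF : MvPolynomial.eval p F ≠ 0 := by
    intro hF
    rw [h p hG, hF, zero_div] at h0
    exact h0 rfl
  refine ⟨G * G, F * G, by simp [hG, hF], fun x hx => ?_⟩
  rw [map_mul, mul_ne_zero_iff] at hx
  have h1 := hx.1
  have h2 := hx.2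
  simp only [h x hx.2, map_mul]
  field_simp

lemma neg (hf : RatAt f p) : RatAt (fun x => - f x) p := by
  simpa using (const (-1)).mul hf

lemma sub (hf : RatAt f p) (hg : RatAt g p) : RatAt (fun x => f x - g x) p := by
  simpa [sub_eq_add_neg] using hf.add hg.neg

lemma div (hf : RatAt f p) (hg : RatAt g p) (h0 : g p ≠ 0) : RatAt (fun x => f x / g x) p := by
  simpa [div_eq_mul_inv] using hf.mul (hg.inv h0)

lemma pow (hf : RatAt f p) (n : ℕ) : RatAt (fun x => f x ^ n) p := by
  induction n with
  | zero => simpa using const 1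
  | succ n ih => simpa [pow_succ] using ih.mul hf

lemma eventually_ne (hf : RatAt f p) (h0 : f p ≠ 0) : ∀ᶠ x in zNhds p, f x ≠ 0 := by
  obtain ⟨F, G, hG, h⟩ := hf
  have hF : MvPolynomial.eval p F ≠ 0 := by
    intro hF
    rw [h p hG, hF, zero_div] at h0
    exact h0 rfl
  refine mem_zNhds.2 ⟨F * G, by simp [hG, hF], fun x hx => ?_⟩
  rw [map_mul, mul_ne_zero_iff] at hx
  show f x ≠ 0
  rw [h x hx.2]
  exact div_ne_zero hx.1 hx.2

lemma congr' (hf : RatAt f p) (h : ∀ᶠ x in zNhds p, g x = f x) : RatAt g p := by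
  obtain ⟨F, G, hG, hf⟩ := hf
  obtain ⟨H, hH, h⟩ := mem_zNhds.1 h
  refine ⟨F * H, G * H, by simp [hG, hH], fun x hx => ?_⟩
  rw [map_mul, mul_ne_zero_iff] at hx
  rw [show g x = f x from h x hx.2, hf x hx.1, map_mul, map_mul, mul_div_mul_right _ _ hx.2]

/-- A rational function can be written as a quotient whose denominator is supported in a given
neighbourhood. -/
lemma exists_eq_div {s : Set Plane} (hf : RatAt f p) (hs : s ∈ zNhds p) :
    ∃ F G : MvPolynomial (Fin 2) ℂ, MvPolynomial.eval p G ≠ 0 ∧ ∀ x, MvPolynomial.eval x G ≠ 0 →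
      x ∈ s ∧ f x = MvPolynomial.eval x F / MvPolynomial.eval x G := by
  obtain ⟨F, G, hG, hf⟩ := hf
  obtain ⟨H, hH, h⟩ := mem_zNhds.1 hs
  refine ⟨F * H, G * H, by simp [hG, hH], fun x hx => ?_⟩
  rw [map_mul, mul_ne_zero_iff] at hx
  rw [hf x hx.1, map_mul, map_mul, mul_div_mul_right _ _ hx.2]
  exact ⟨h x hx.2, rfl⟩

lemma eval_comp {g : Plane → Plane} (hg : RatMapAt g p) (F : MvPolynomial (Fin 2) ℂ) :
    RatAt (fun x => MvPolynomial.eval (g x) F) p := by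
  induction F using MvPolynomial.induction_on with
  | C a => simpa using const a
  | add F G hF hG => simpa using hF.add hG
  | mul_X F i hF => simpa using hF.mul (hg i)

lemma comp {g : Plane → Plane} (hf : RatAt f (g p)) (hg : RatMapAt g p) :
    RatAt (fun x => f (g x)) p := by
  obtain ⟨F, G, hG, h⟩ := hf
  refine ((eval_comp hg F).div (eval_comp hg G) hG).congr' ?_
  filter_upwards [(eval_comp hg G).eventually_ne hG] with x hx
  exact h _ hx

/-- Rational functions that agree generically agree wherever they are regular. -/
lemma eq_of_eventuallyEq (hf : RatAt f p) (hg : RatAt g p) (h : f =ᶠ[zGen] g) : f p = g p := by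
  obtain ⟨F, G, hG, hf⟩ := hf
  obtain ⟨F', G', hG', hg⟩ := hg
  have key : F * G' - F' * G = 0 := by
    by_contra hne
    have h1 : ∀ᶠ x in zGen, MvPolynomial.eval x (F * G' - F' * G) ≠ 0 :=
      mem_zGen.2 ⟨_, hne, fun x hx => hx⟩
    have h2 : ∀ᶠ x in zGen, MvPolynomial.eval x (G * G') ≠ 0 :=
      mem_zGen.2 ⟨_, mul_ne_zero (by rintro rfl; simp at hG) (by rintro rfl; simp at hG'),
        fun x hx => hx⟩
    obtain ⟨x, hx, hx1, hx2⟩ := (h.and (h1.and h2)).exists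
    rw [map_mul, mul_ne_zero_iff] at hx2
    rw [hf x hx2.1, hg x hx2.2, div_eq_div_iff hx2.1 hx2.2] at hx
    simp [hx] at hx1
  rw [hf p hG, hg p hG', div_eq_div_iff hG hG']
  have := congrArg (MvPolynomial.eval p) key
  simpa [sub_eq_zero] using this

end RatAt

namespace RatMapAt

variable {f g : Plane → Plane} {p : Plane}

lemma id : RatMapAt (fun x => x) p := fun k => RatAt.coord k

lemma mk {u v : Plane → ℂ} (hu : RatAt u p) (hv : RatAt v p) :
    RatMapAt (fun x => ![u x, v x]) p := by
  intro k
  fin_cases k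
  · exact hu
  · exact hv

lemma comp (hf : RatMapAt f (g p)) (hg : RatMapAt g p) : RatMapAt (fun x => f (g x)) p :=
  fun k => (hf k).comp hg

lemma tendsto (hg : RatMapAt g p) : Tendsto g (zNhds p) (zNhds (g p)) := by
  rintro s ⟨G, hG, h⟩
  rw [mem_map]
  filter_upwards [(RatAt.eval_comp hg G).eventually_ne hG] with x hx
  exact h _ hx

lemma eq_of_eventuallyEq (hf : RatMapAt f p) (hg : RatMapAt g p) (h : f =ᶠ[zGen] g) :
    f p = g p :=
  funext fun k => (hf k).eq_of_eventuallyEq (hg k) (h.mono fun _ hx => congrFun hx k)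

end RatMapAt

/-! ### Birational transformations of the plane -/

/-- A bijection between subsets of the plane containing nonempty Zariski open sets, which is
rational and regular in both directions. -/
structure IsBirational (e : PartialEquiv Plane Plane) : Prop where
  source_mem : e.source ∈ zGen
  target_mem : e.target ∈ zGen
  rat : ∀ p ∈ e.source, RatMapAt e p
  rat_symm : ∀ p ∈ e.target, RatMapAt e.symm p

namespace IsBirational

variable {e e' : PartialEquiv Plane Plane}

lemma symm (h : IsBirational e) : IsBirational e.symm :=
  ⟨h.target_mem, h.source_mem, h.rat_symm, h.rat⟩

lemma tendsto (h : IsBirational e) : Tendsto e zGen zGen := by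
  rintro s ⟨H, hH, hs⟩
  obtain ⟨p, hp⟩ := (show ∀ᶠ x in zGen, x ∈ e.source from h.source_mem).exists
  obtain ⟨F, G, hG, hFG⟩ := RatAt.eval_comp (h.rat p hp) H
  have hG0 : G ≠ 0 := by rintro rfl; simp at hG
  -- F is the numerator of H ∘ e. Were it zero, H would vanish at e (e⁻¹ x) = x for generic x,
  -- against H ≠ 0; so e is dominant.
  by_cases hF : F = 0
  · exfalso
    have h1 : RatAt (fun x => MvPolynomial.eval (e.symm x) G) (e p) :=
      RatAt.eval_comp (h.rat_symm _ (e.map_source hp)) G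
    have h2 : ∀ᶠ x in zGen, MvPolynomial.eval (e.symm x) G ≠ 0 :=
      zGen_le_zNhds _ (h1.eventually_ne (by rwa [e.left_inv hp]))
    have h3 : ∀ᶠ x in zGen, MvPolynomial.eval x H ≠ 0 := mem_zGen.2 ⟨_, hH, fun x hx => hx⟩
    have h4 : ∀ᶠ x in zGen, x ∈ e.target := h.target_mem
    obtain ⟨x, hx2, hx3, hx4⟩ := (h2.and (h3.and h4)).exists
    have : MvPolynomial.eval (e (e.symm x)) H = _ := hFG _ hx2
    rw [e.right_inv hx4, hF] at this
    simp at this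
    exact hx3 this
  · refine mem_zGen.2 ⟨F * G, mul_ne_zero hF hG0, fun x hx => hs _ ?_⟩
    rw [map_mul, mul_ne_zero_iff] at hx
    rw [show MvPolynomial.eval (e x) H = _ from hFG x hx.2]
    exact div_ne_zero hx.1 hx.2

lemma trans (h : IsBirational e) (h' : IsBirational e') : IsBirational (e.trans e') where
  source_mem := by
    rw [e.trans_source]
    exact inter_mem h.source_mem (h.tendsto h'.source_mem)
  target_mem := by
    rw [e.trans_target]
    exact inter_mem h'.target_mem (h'.symm.tendsto h.target_mem)
  rat := by
    intro p hp
    rw [e.trans_source] at hp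
    exact (h'.rat _ hp.2).comp (h.rat _ hp.1)
  rat_symm := by
    intro p hp
    rw [e.trans_target] at hp
    exact (h.rat_symm _ hp.2).comp (h'.rat_symm _ hp.1)

end IsBirational

attribute [fun_prop] RatAt
attribute [fun_prop] RatAt.const RatAt.coord RatAt.add RatAt.mul RatAt.inv RatAt.neg RatAt.sub
  RatAt.div RatAt.pow

noncomputable section

/-! ### Surfaces given by ordered pairs of points on four lines -/

/-- The lines `y = 0`, `y = ∞`, `ξ = 0`, `ξ = ∞`. -/
inductive Line : Type
  | y0 | yi | x0 | xi

/-- The point with local coordinate `t` transversal to the line, and with other coordinate `o`. -/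
def Line.pt : Line → ℂ → ℂ → Plane
  | .y0, t, o => ![t, o]
  | .yi, t, o => ![t⁻¹, o]
  | .x0, t, o => ![o, t]
  | .xi, t, o => ![o, t⁻¹]

/-- The torus `ℂ* × ℂ*`. -/
def torus : Set Plane := {x | x 0 ≠ 0 ∧ x 1 ≠ 0}

lemma Line.pt_mem_torus {ℓ : Line} {t o : ℂ} : ℓ.pt t o ∈ torus ↔ t ≠ 0 ∧ o ≠ 0 := by
  cases ℓ <;> simp [Line.pt, torus, and_comm]

/-- Two points on each of the four lines, blown up one after the other. If the points coincide,
the second centre is the point of the exceptional curve on the strict transform of the line. -/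
structure Model where
  e : Line → ℂ
  f : Line → ℂ
  e_ne : ∀ ℓ, e ℓ ≠ 0
  f_ne : ∀ ℓ, f ℓ ≠ 0

namespace Model

variable (M : Model)

/-- The local coordinate transversal to the line, in the two charts at the line. -/
def t (ℓ : Line) : Bool → Plane → ℂ
  | false, p => p 0
  | true, p => p 0 * (M.f ℓ + p 0 * p 1 - M.e ℓ)

/-- The coordinate along the line, in the two charts at the line. -/
def o (ℓ : Line) : Bool → Plane → ℂ
  | false, p => M.e ℓ + p 0 * p 1
  | true, p => M.f ℓ + p 0 * p 1

/-- The domain of a chart. -/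
def dom (ℓ : Line) (b : Bool) : Set Plane := {p | M.o ℓ b p ≠ 0}

/-- The parametrization of the torus given by a chart. -/
def param (ℓ : Line) (b : Bool) (p : Plane) : Plane := ℓ.pt (M.t ℓ b p) (M.o ℓ b p)

@[fun_prop]
lemma ratAt_t (ℓ : Line) (b : Bool) (p : Plane) : RatAt (fun x => M.t ℓ b x) p := by
  cases b <;> simp only [t] <;> fun_prop

@[fun_prop]
lemma ratAt_o (ℓ : Line) (b : Bool) (p : Plane) : RatAt (fun x => M.o ℓ b x) p := by
  cases b <;> simp only [o] <;> fun_prop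

end Model

/-- The map `φ ∘ ρ`, where `φ` is defined on `S`, lifts at `p` to a regular map to the surface. -/
def Lifts (M : Model) (φ : Plane → Plane) (S : Set Plane) (ρ : Plane → Plane) (p : Plane) : Prop :=
  ∃ ℓ b, ∃ g : Plane → Plane, RatMapAt g p ∧ g p ∈ M.dom ℓ b ∧
    ∀ᶠ x in zNhds p, ρ x ∈ S → M.param ℓ b (g x) = φ (ρ x)

/-- The map `φ`, defined on `S`, extends to a regular map between the surfaces. -/
def Reg (M M' : Model) (φ : Plane → Plane) (S : Set Plane) : Prop :=
  ∀ ℓ b, ∀ p ∈ M.dom ℓ b, Lifts M' φ S (M.param ℓ b) p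

namespace Lifts

variable {M : Model} {φ : Plane → Plane} {S : Set Plane} {ρ : Plane → Plane} {p : Plane}

lemma first (ℓ : Line) {T U : Plane → ℂ} (hT : RatAt T p) (hU : RatAt U p)
    (h0 : M.e ℓ + T p * U p ≠ 0)
    (h : ∀ᶠ x in zNhds p, ρ x ∈ S → ℓ.pt (T x) (M.e ℓ + T x * U x) = φ (ρ x)) :
    Lifts M φ S ρ p :=
  ⟨ℓ, false, fun x => ![T x, U x], RatMapAt.mk hT hU, h0, h⟩

lemma second (ℓ : Line) {U V : Plane → ℂ} (hU : RatAt U p) (hV : RatAt V p)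
    (h0 : M.f ℓ + U p * V p ≠ 0)
    (h : ∀ᶠ x in zNhds p, ρ x ∈ S →
      ℓ.pt (U x * (M.f ℓ + U x * V x - M.e ℓ)) (M.f ℓ + U x * V x) = φ (ρ x)) :
    Lifts M φ S ρ p :=
  ⟨ℓ, true, fun x => ![U x, V x], RatMapAt.mk hU hV, h0, h⟩

lemma comp_param {ρ' : Plane → Plane} {g : Plane → Plane} (h : Lifts M φ S ρ' (g p))
    (hg : RatMapAt g p) (hρ : ∀ᶠ x in zNhds p, ρ x = ρ' (g x)) : Lifts M φ S ρ p := by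
  obtain ⟨ℓ, b, k, hk, hkp, h⟩ := h
  refine ⟨ℓ, b, fun x => k (g x), hk.comp hg, hkp, ?_⟩
  filter_upwards [hρ, hg.tendsto h] with x hx hx' hS
  rw [hx] at hS ⊢
  exact hx' hS

/-- The first lift lands at a point g p of a chart of the middle surface, possibly on an exceptional
curve, and regularity of φ' is available at precisely such points. -/
lemma trans {M' : Model} {φ' : Plane → Plane} {S' : Set Plane} (h : Lifts M φ S ρ p)
    (h' : Reg M M' φ' S') : Lifts M' (φ' ∘ φ) (S ∩ φ ⁻¹' S') ρ p := by
  obtain ⟨ℓ, b, g, hg, hgp, h⟩ := h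
  obtain ⟨ℓ', b', g', hg', hgp', h'⟩ := h' ℓ b _ hgp
  refine ⟨ℓ', b', fun x => g' (g x), hg'.comp hg, hgp', ?_⟩
  filter_upwards [h, hg.tendsto h'] with x hx hx' hS
  have h2 : φ (ρ x) ∈ S' := hS.2
  rw [← hx hS.1] at h2
  rw [Function.comp, ← hx hS.1]
  exact hx' h2

end Lifts

/-- To check regularity it suffices to consider one chart containing the torus, and the points on
the exceptional curves in the other charts. -/
lemma Reg.of_charts {M M' : Model} {φ : Plane → Plane} {S : Set Plane}
    (h0 : ∀ p ∈ M.dom .y0 false, Lifts M' φ S (M.param .y0 false) p)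
    (h : ∀ ℓ b, ∀ p ∈ M.dom ℓ b, M.t ℓ b p = 0 → Lifts M' φ S (M.param ℓ b) p) :
    Reg M M' φ S := by
  intro ℓ b p hp
  by_cases ht : M.t ℓ b p = 0
  · exact h ℓ b p hp ht
  have hp' : M.param ℓ b p ∈ torus := Line.pt_mem_torus.2 ⟨ht, hp⟩
  have hr : RatMapAt (M.param ℓ b) p := by
    cases ℓ <;> refine RatMapAt.mk ?_ ?_ <;> fun_prop (disch := assumption)
  have hr0 := hr 0
  have hr1 := hr 1
  have hy := hp'.1
  -- The first chart at y = 0 has coordinates y and (ξ - e)/y, and so reaches every point of the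
  -- torus.
  refine Lifts.comp_param
    (g := fun x => ![M.param ℓ b x 0, (M.param ℓ b x 1 - M.e .y0) / M.param ℓ b x 0])
    (h0 _ ?_) (RatMapAt.mk hr0 ?_) ?_
  · simp only [Model.dom, Model.o, Set.mem_ofPred_eq, Matrix.cons_val_zero, Matrix.cons_val_one]
    rw [mul_div_cancel₀ _ hy]
    simpa using hp'.2
  · fun_prop (disch := assumption)
  · filter_upwards [hr0.eventually_ne hy] with x hx
    simp only [Model.param, Line.pt, Model.t, Model.o, Matrix.cons_val_zero, Matrix.cons_val_one]
      at hx ⊢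
    rw [mul_div_cancel₀ _ hx]
    ext i
    fin_cases i <;> simp

/-- Multiplication by a unit of the coordinate along a line. -/
lemma Lifts.of_unit {M M' : Model} {φ : Plane → Plane} {S : Set Plane} (ℓ : Line) {h0 : ℂ}
    (hh0 : h0 ≠ 0) (he : M'.e ℓ = h0 * M.e ℓ) (hf : M'.f ℓ = h0 * M.f ℓ)
    {b : Bool} {p : Plane} (hp : p ∈ M.dom ℓ b) (ht : M.t ℓ b p = 0) {g : Plane → ℂ}
    (hg : RatAt g p)
    (hφ : ∀ x, M.param ℓ b x ∈ S →
      φ (M.param ℓ b x) = ℓ.pt (M.t ℓ b x) ((h0 + M.t ℓ b x * g x) * M.o ℓ b x)) :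
    Lifts M' φ S (M.param ℓ b) p := by
  cases b with
  | false =>
    simp only [Model.t, Model.o, Model.dom, Set.mem_ofPred_eq] at ht hp
    refine Lifts.first ℓ (T := fun x => x 0)
      (U := fun x => M.e ℓ * g x + (h0 + x 0 * g x) * x 1) (by fun_prop) (by fun_prop)
      ?_ (Eventually.of_forall fun x hx => ?_)
    · rw [ht, he, zero_mul, add_zero]
      exact mul_ne_zero hh0 (M.e_ne ℓ)
    · rw [hφ x hx]
      simp only [Model.t, Model.o, he]
      congr 1
      ring
  | true =>
    simp only [Model.t, Model.o, Model.dom, Set.mem_ofPred_eq] at ht hp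
    set o : Plane → ℂ := fun x => M.f ℓ + x 0 * x 1 with ho
    set t : Plane → ℂ := fun x => x 0 * (M.f ℓ + x 0 * x 1 - M.e ℓ) with htt
    have hto : ∀ x, t x = x 0 * (o x - M.e ℓ) := fun x => rfl
    have hto' : ∀ x, o x = M.f ℓ + x 0 * x 1 := fun x => rfl
    -- Since t = x₀(o - e), the new value of o - e is (h0 + t g)o - h0 e = (o - e)K. The new
    -- second-chart coordinate t/(o - e) is thus x₀/K. It breaks down when K = 0; then x₀ ≠ 0, and
    -- the first-chart coordinate K/x₀ is regular instead.
    set K : Plane → ℂ := fun x => h0 + x 0 * g x * o x with hK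
    have hor : RatAt o p := by rw [ho]; fun_prop
    have hKr : RatAt K p := by rw [hK]; fun_prop
    have hpar : ∀ x, M.param ℓ true x ∈ S →
        φ (M.param ℓ true x) = ℓ.pt (t x) ((h0 + t x * g x) * o x) := hφ
    by_cases hKp : K p = 0
    · have hp0 : p 0 ≠ 0 := by
        intro h
        simp [hK, h] at hKp
        exact hh0 hKp
      have hE : ∀ x : Plane, x 0 ≠ 0 →
          M'.e ℓ + t x * (K x / x 0) = (h0 + t x * g x) * o x := by
        intro x hx
        rw [hto, he]
        field_simp
        rw [hK, ← hto]
        ring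
      refine Lifts.first ℓ (T := t) (U := fun x => K x / x 0) (by rw [htt]; fun_prop)
        (by fun_prop (disch := assumption)) ?_ ?_
      · rw [hE p hp0, show t p = 0 from ht]
        simp only [zero_mul, add_zero]
        exact mul_ne_zero hh0 hp
      · filter_upwards [(RatAt.coord 0).eventually_ne hp0] with x hx hS
        rw [hE x hx, hpar _ hS]
    · have hE : ∀ x : Plane, K x ≠ 0 →
          M'.f ℓ + x 0 / K x * ((h0 * x 1 + (o x - M.e ℓ) * g x * o x) * K x) =
            (h0 + t x * g x) * o x := by
        intro x hx
        rw [hto, hf]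
        field_simp
        rw [← hto, hto']
        ring
      refine Lifts.second ℓ (U := fun x => x 0 / K x)
        (V := fun x => (h0 * x 1 + (o x - M.e ℓ) * g x * o x) * K x)
        (by fun_prop (disch := assumption)) (by fun_prop) ?_ ?_
      · rw [hE p hKp, show t p = 0 from ht]
        simp only [zero_mul, add_zero]
        exact mul_ne_zero hh0 hp
      · filter_upwards [hKr.eventually_ne hKp] with x hx hS
        rw [hE x hx, hpar _ hS]
        congr 1
        rw [he]
        field_simp
        rw [hto, hK, ← hto]
        ring

end

/-! ### Isomorphisms between models, and the elementary ones -/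

noncomputable section

/-- A birational transformation of the torus that extends to an isomorphism of the surfaces. -/
structure ModelIso (M M' : Model) (e : PartialEquiv Plane Plane) : Prop where
  birational : IsBirational e
  source_subset : e.source ⊆ torus
  target_subset : e.target ⊆ torus
  reg : Reg M M' e e.source
  reg_symm : Reg M' M e.symm e.target

namespace ModelIso

variable {M M' M'' : Model} {e e' : PartialEquiv Plane Plane}

lemma symm (h : ModelIso M M' e) : ModelIso M' M e.symm :=
  ⟨h.birational.symm, h.target_subset, h.source_subset, h.reg_symm, h.reg⟩

lemma trans (h : ModelIso M M' e) (h' : ModelIso M' M'' e') : ModelIso M M'' (e.trans e') where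
  birational := h.birational.trans h'.birational
  source_subset := fun _ hx => h.source_subset (e.trans_source e' ▸ hx).1
  target_subset := fun _ hx => h'.target_subset (e.trans_target e' ▸ hx).1
  reg := fun ℓ b p hp => e.trans_source e' ▸ (h.reg ℓ b p hp).trans h'.reg
  reg_symm := fun ℓ b p hp => e.trans_target e' ▸ (h'.reg_symm ℓ b p hp).trans h.reg_symm

end ModelIso

lemma mem_zGen_of_coord_ne (k : Fin 2) (a : ℂ) : {x : Plane | x k ≠ a} ∈ zGen := by
  refine mem_zGen.2 ⟨.X k - .C a, fun h => ?_, fun x hx => ?_⟩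
  · have := congrArg (MvPolynomial.eval (fun _ => a + 1)) h
    simp at this
  · simpa [sub_eq_zero] using hx

lemma torus_mem_zGen : torus ∈ zGen :=
  inter_mem (mem_zGen_of_coord_ne 0 0) (mem_zGen_of_coord_ne 1 0)

/-! #### Transposition -/

/-- The involution exchanging the two coordinates. -/
def Line.tr : Line → Line
  | .y0 => .x0
  | .yi => .xi
  | .x0 => .y0
  | .xi => .yi

lemma Line.tr_tr (ℓ : Line) : ℓ.tr.tr = ℓ := by cases ℓ <;> rfl

/-- The surface with the two coordinates exchanged. -/
def Model.tr (M : Model) : Model :=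
  ⟨M.e ∘ Line.tr, M.f ∘ Line.tr, fun _ => M.e_ne _, fun _ => M.f_ne _⟩

/-- The transposition of the two coordinates. -/
def swapCoord (x : Plane) : Plane := ![x 1, x 0]

lemma swapCoord_swapCoord (x : Plane) : swapCoord (swapCoord x) = x := by
  ext i
  fin_cases i <;> simp [swapCoord]

lemma Line.pt_tr (ℓ : Line) (t o : ℂ) : ℓ.tr.pt t o = swapCoord (ℓ.pt t o) := by
  cases ℓ <;> simp [Line.tr, Line.pt, swapCoord]

lemma Model.param_tr (M : Model) (ℓ : Line) (b : Bool) (p : Plane) :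
    M.tr.param ℓ b p = swapCoord (M.param ℓ.tr b p) := by
  have h := Line.pt_tr ℓ.tr (M.t ℓ.tr b p) (M.o ℓ.tr b p)
  rw [Line.tr_tr] at h
  rw [Model.param, Model.param, ← h]
  cases b <;> rfl

lemma Model.dom_tr (M : Model) (ℓ : Line) (b : Bool) : M.tr.dom ℓ b = M.dom ℓ.tr b := by
  cases b <;> rfl

lemma ratMapAt_swapCoord (p : Plane) : RatMapAt swapCoord p :=
  RatMapAt.mk (RatAt.coord 1) (RatAt.coord 0)

/-- The transposition of the two coordinates, as an equivalence. -/
def swapEquiv : PartialEquiv Plane Plane where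
  toFun := swapCoord
  invFun := swapCoord
  source := Set.univ
  target := Set.univ
  map_source' := by simp
  map_target' := by simp
  left_inv' := fun x _ => swapCoord_swapCoord x
  right_inv' := fun x _ => swapCoord_swapCoord x

lemma isBirational_swapEquiv : IsBirational swapEquiv :=
  ⟨univ_mem, univ_mem, fun p _ => ratMapAt_swapCoord p, fun p _ => ratMapAt_swapCoord p⟩

/-- The conjugate by the transposition of the coordinates. -/
def conjSwap (e : PartialEquiv Plane Plane) : PartialEquiv Plane Plane :=
  (swapEquiv.trans e).trans swapEquiv

lemma conjSwap_source (e : PartialEquiv Plane Plane) :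
    (conjSwap e).source = swapCoord ⁻¹' e.source := by
  simp [conjSwap, swapEquiv]

lemma conjSwap_target (e : PartialEquiv Plane Plane) :
    (conjSwap e).target = swapCoord ⁻¹' e.target := by
  simp [conjSwap, swapEquiv, PartialEquiv.trans_target]

lemma Reg.tr {M M' : Model} {φ : Plane → Plane} {S : Set Plane} (h : Reg M M' φ S) :
    Reg M.tr M'.tr (swapCoord ∘ φ ∘ swapCoord) (swapCoord ⁻¹' S) := by
  intro ℓ b p hp
  rw [Model.dom_tr] at hp
  obtain ⟨ℓ', b', g, hg, hgp, h⟩ := h ℓ.tr b p hp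
  refine ⟨ℓ'.tr, b', g, hg, ?_, h.mono fun x hx hS => ?_⟩
  · rwa [Model.dom_tr, Line.tr_tr]
  · simp only [Model.param_tr, Set.mem_preimage, swapCoord_swapCoord, Line.tr_tr,
      Function.comp] at hS ⊢
    rw [hx hS]

lemma ModelIso.tr {M M' : Model} {e : PartialEquiv Plane Plane} (h : ModelIso M M' e) :
    ModelIso M.tr M'.tr (conjSwap e) where
  birational := (isBirational_swapEquiv.trans h.birational).trans isBirational_swapEquiv
  source_subset := by
    rw [conjSwap_source]
    exact fun x hx => ⟨(h.source_subset hx).2, (h.source_subset hx).1⟩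
  target_subset := by
    rw [conjSwap_target]
    exact fun x hx => ⟨(h.target_subset hx).2, (h.target_subset hx).1⟩
  reg := conjSwap_source e ▸ h.reg.tr
  reg_symm := conjSwap_target e ▸ h.reg_symm.tr

/-! #### Identity and change of order -/

lemma Model.reg_refl {M : Model} {φ : Plane → Plane} {S : Set Plane} (hφ : ∀ x ∈ S, φ x = x) :
    Reg M M φ S := fun ℓ b _ hp =>
  ⟨ℓ, b, fun x => x, RatMapAt.id, hp, Eventually.of_forall fun _ hx => (hφ _ hx).symm⟩

/-- The identity of the torus. -/
def torusRefl : PartialEquiv Plane Plane := PartialEquiv.ofSet torus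

lemma isBirational_torusRefl : IsBirational torusRefl :=
  ⟨torus_mem_zGen, torus_mem_zGen, fun _ _ => RatMapAt.id, fun _ _ => RatMapAt.id⟩

/-- Near a point of a chart, the first chart lifts to the surface in which the order is changed. -/
lemma Lifts.of_first_swap {M M' : Model} {ℓ : Line} (he : M'.e ℓ = M.f ℓ) (hf : M'.f ℓ = M.e ℓ)
    (hne : M.e ℓ ≠ M.f ℓ) {p : Plane} (hp : p ∈ M.dom ℓ false) :
    Lifts M' (fun x => x) torus (M.param ℓ false) p := by
  have hp' : M.e ℓ + p 0 * p 1 ≠ 0 := hp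
  -- Where o = f, distinctness of the centres forces t ≠ 0, and the first chart at f serves.
  -- Elsewhere t/(o - f) is regular, which is what the second chart of the reordered surface needs.
  by_cases ho : M.e ℓ + p 0 * p 1 - M.f ℓ = 0
  · have h0 : p 0 ≠ 0 := by
      intro h
      rw [h, zero_mul, add_zero] at ho
      exact hne (sub_eq_zero.1 ho)
    refine Lifts.first ℓ (T := fun x => x 0) (U := fun x => (M.e ℓ + x 0 * x 1 - M.f ℓ) / x 0)
      (by fun_prop) (by fun_prop (disch := assumption)) ?_ ?_
    · rw [mul_div_cancel₀ _ h0, he]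
      simpa using hp'
    · filter_upwards [(RatAt.coord 0).eventually_ne h0] with x hx _
      rw [mul_div_cancel₀ _ hx, he]
      simp [Model.param, Model.t, Model.o]
  · refine Lifts.second ℓ (U := fun x => x 0 / (M.e ℓ + x 0 * x 1 - M.f ℓ))
      (V := fun x => x 1 * (M.e ℓ + x 0 * x 1 - M.f ℓ))
      (by fun_prop (disch := assumption)) (by fun_prop) ?_ ?_
    · rw [hf]
      convert hp' using 2
      field_simp
    · filter_upwards [RatAt.eventually_ne (f := fun x => M.e ℓ + x 0 * x 1 - M.f ℓ)
        (by fun_prop) ho] with x hx _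
      have : M'.f ℓ + x 0 / (M.e ℓ + x 0 * x 1 - M.f ℓ) * (x 1 * (M.e ℓ + x 0 * x 1 - M.f ℓ)) =
          M.e ℓ + x 0 * x 1 := by
        rw [hf]
        field_simp
      rw [this, he]
      simp only [Model.param, Model.t, Model.o]
      rw [div_mul_cancel₀ _ hx]

/-- The second chart of a surface is covered by the first charts at the two centres. -/
lemma Model.second_cover {M : Model} {ℓ : Line} (hne : M.e ℓ ≠ M.f ℓ) {p : Plane}
    (hp : p ∈ M.dom ℓ true) :
    ∃ c, (c = M.e ℓ ∨ c = M.f ℓ) ∧ ∃ g : Plane → Plane, RatMapAt g p ∧ c + g p 0 * g p 1 ≠ 0 ∧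
      ∀ᶠ x in zNhds p, M.param ℓ true x = ℓ.pt (g x 0) (c + g x 0 * g x 1) := by
  have hp' : M.f ℓ + p 0 * p 1 ≠ 0 := hp
  -- With t = x₀(o - e), the slope at e is (o - e)/t = 1/x₀, and the slope at f is (o - f)/t = x₁/(o
  -- - e). At each point one of the two is regular.
  by_cases ho : M.f ℓ + p 0 * p 1 - M.e ℓ = 0
  · have h0 : p 0 ≠ 0 := by
      intro h
      rw [h, zero_mul, add_zero] at ho
      exact hne (sub_eq_zero.1 ho).symm
    refine ⟨_, Or.inl rfl, fun x => ![x 0 * (M.f ℓ + x 0 * x 1 - M.e ℓ), 1 / x 0],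
      RatMapAt.mk (by fun_prop) (by fun_prop (disch := assumption)), ?_, ?_⟩
    · simp [ho, M.e_ne]
    · filter_upwards [(RatAt.coord 0).eventually_ne h0] with x hx
      simp only [Model.param, Model.t, Model.o, Matrix.cons_val_zero, Matrix.cons_val_one]
      congr 1
      field_simp
      ring
  · refine ⟨_, Or.inr rfl, fun x => ![x 0 * (M.f ℓ + x 0 * x 1 - M.e ℓ),
      x 1 / (M.f ℓ + x 0 * x 1 - M.e ℓ)],
      RatMapAt.mk (by fun_prop) (by fun_prop (disch := assumption)), ?_, ?_⟩
    · simp only [Matrix.cons_val_zero, Matrix.cons_val_one]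
      convert hp' using 2
      field_simp
    · filter_upwards [RatAt.eventually_ne (f := fun x => M.f ℓ + x 0 * x 1 - M.e ℓ)
        (by fun_prop) ho] with x hx
      simp only [Model.param, Model.t, Model.o, Matrix.cons_val_zero, Matrix.cons_val_one]
      congr 1
      field_simp

/-- The order of two distinct centres can be changed. -/
lemma Model.reg_swap {M M' : Model} (ℓ₀ : Line) (he : M'.e ℓ₀ = M.f ℓ₀) (hf : M'.f ℓ₀ = M.e ℓ₀)
    (he' : ∀ ℓ, ℓ ≠ ℓ₀ → M'.e ℓ = M.e ℓ) (hf' : ∀ ℓ, ℓ ≠ ℓ₀ → M'.f ℓ = M.f ℓ)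
    (hne : M.e ℓ₀ ≠ M.f ℓ₀) : Reg M M' (fun x => x) torus := by
  intro ℓ b p hp
  by_cases hℓ : ℓ = ℓ₀
  · subst hℓ
    cases b with
    | false => exact Lifts.of_first_swap he hf hne hp
    | true =>
      obtain ⟨c, hc, g, hg, hgp, h⟩ := Model.second_cover hne hp
      rcases hc with rfl | rfl
      · exact (Lifts.of_first_swap he hf hne (p := g p) hgp).comp_param hg h
      · refine Lifts.first ℓ (hg 0) (hg 1) (by rwa [he]) (h.mono fun x hx _ => ?_)
        rw [hx, he]
  · refine ⟨ℓ, b, fun x => x, RatMapAt.id, ?_, Eventually.of_forall fun x _ => ?_⟩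
    · cases b <;> simpa only [Model.dom, Model.o, he' ℓ hℓ, hf' ℓ hℓ] using hp
    · cases b <;> simp only [Model.param, Model.t, Model.o, he' ℓ hℓ, hf' ℓ hℓ]

/-- Blow-ups at distinct points commute. If the two values coincide, exchanging them leaves the
model literally unchanged, so no distinctness is required. -/
lemma ModelIso.swap {M M' : Model} (ℓ₀ : Line) (he : M'.e ℓ₀ = M.f ℓ₀) (hf : M'.f ℓ₀ = M.e ℓ₀)
    (he' : ∀ ℓ, ℓ ≠ ℓ₀ → M'.e ℓ = M.e ℓ) (hf' : ∀ ℓ, ℓ ≠ ℓ₀ → M'.f ℓ = M.f ℓ) :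
    ModelIso M M' torusRefl := by
  by_cases hne : M.e ℓ₀ = M.f ℓ₀
  · have : M' = M := by
      cases M
      cases M'
      simp only [Model.mk.injEq]
      constructor <;> ext ℓ <;> by_cases hℓ : ℓ = ℓ₀
      · subst hℓ
        exact he.trans hne.symm
      · exact he' ℓ hℓ
      · subst hℓ
        exact hf.trans hne
      · exact hf' ℓ hℓ
    subst this
    exact ⟨isBirational_torusRefl, subset_rfl, subset_rfl, Model.reg_refl fun _ _ => rfl,
      Model.reg_refl fun _ _ => rfl⟩
  · exact ⟨isBirational_torusRefl, subset_rfl, subset_rfl, Model.reg_swap ℓ₀ he hf he' hf' hne,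
      Model.reg_swap ℓ₀ hf.symm he.symm (fun ℓ h => (he' ℓ h).symm) (fun ℓ h => (hf' ℓ h).symm)
        (by rw [he, hf]; exact Ne.symm hne)⟩

end

noncomputable section

lemma plane_ext {x y : Plane} (h0 : x 0 = y 0) (h1 : x 1 = y 1) : x = y := by
  ext i
  fin_cases i
  · exact h0
  · exact h1

/-! #### Inversion of `y` -/

/-- The map `(y, ξ) ↦ (μ / y, ξ)`. -/
def invFun (μ : ℂ) (x : Plane) : Plane := ![μ / x 0, x 1]

/-- The map `(y, ξ) ↦ (μ / y, ξ)` on the torus. -/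
def invEquiv (μ : ℂ) (hμ : μ ≠ 0) : PartialEquiv Plane Plane where
  toFun := invFun μ
  invFun := invFun μ
  source := torus
  target := torus
  map_source' := fun _ hx => ⟨div_ne_zero hμ hx.1, hx.2⟩
  map_target' := fun _ hx => ⟨div_ne_zero hμ hx.1, hx.2⟩
  left_inv' := fun x hx => plane_ext (by
    have := hx.1
    simp only [_root_.invFun, Matrix.cons_val_zero]
    field_simp) rfl
  right_inv' := fun x hx => plane_ext (by
    have := hx.1
    simp only [_root_.invFun, Matrix.cons_val_zero]
    field_simp) rfl

lemma isBirational_invEquiv (μ : ℂ) (hμ : μ ≠ 0) : IsBirational (invEquiv μ hμ) := by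
  have h : ∀ p ∈ torus, RatMapAt (invFun μ) p := fun p hp => by
    have := hp.1
    refine RatMapAt.mk ?_ ?_ <;> fun_prop (disch := assumption)
  exact ⟨torus_mem_zGen, torus_mem_zGen, h, h⟩

/-- The lines y = 0 and y = ∞ are exchanged, with the transversal coordinate only rescaled (`hy`).
On ξ = 0 and ξ = ∞ the coordinate o becomes μ/o, and μ/o - μ/e = -μ(o - e)/(o e) gives the new chart
coordinates (`key`). -/
lemma Model.reg_inv {M M' : Model} {μ : ℂ} (hμ : μ ≠ 0)
    (h1 : M'.e .y0 = M.e .yi) (h2 : M'.f .y0 = M.f .yi)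
    (h3 : M'.e .yi = M.e .y0) (h4 : M'.f .yi = M.f .y0)
    (h5 : M'.e .x0 = μ / M.e .x0) (h6 : M'.f .x0 = μ / M.f .x0)
    (h7 : M'.e .xi = μ / M.e .xi) (h8 : M'.f .xi = μ / M.f .xi) :
    Reg M M' (invFun μ) torus := by
  have key : ∀ ℓ, (∀ t o, invFun μ (ℓ.pt t o) = ℓ.pt t (μ / o)) → M'.e ℓ = μ / M.e ℓ →
      M'.f ℓ = μ / M.f ℓ → ∀ b, ∀ p ∈ M.dom ℓ b, M.t ℓ b p = 0 →
      Lifts M' (invFun μ) torus (M.param ℓ b) p := by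
    intro ℓ hφ he hf b p hp ht
    have hd : M.o ℓ b p ≠ 0 := hp
    have hen := M.e_ne ℓ
    have hfn := M.f_ne ℓ
    have hd' := (M.ratAt_o ℓ b p).eventually_ne hd
    cases b with
    | false =>
      simp only [Model.o] at hd hd'
      have hE : ∀ x : Plane, M.e ℓ + x 0 * x 1 ≠ 0 →
          M'.e ℓ + x 0 * (-μ * x 1 / ((M.e ℓ + x 0 * x 1) * M.e ℓ)) = μ / (M.e ℓ + x 0 * x 1) := by
        intro x hx
        rw [he]
        field_simp
        ring
      have hd2 : (M.e ℓ + p 0 * p 1) * M.e ℓ ≠ 0 := mul_ne_zero hd hen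
      refine Lifts.first ℓ (T := fun x => x 0)
        (U := fun x => -μ * x 1 / ((M.e ℓ + x 0 * x 1) * M.e ℓ)) (by fun_prop)
        (by fun_prop (disch := assumption)) ?_ ?_
      · rw [hE p hd]
        exact div_ne_zero hμ hd
      · filter_upwards [hd'] with x hx _
        rw [hE x hx, Model.param, hφ]
        rfl
    | true =>
      simp only [Model.o] at hd hd'
      have hE : ∀ x : Plane, M.f ℓ + x 0 * x 1 ≠ 0 →
          M'.f ℓ + -(x 0 * (M.f ℓ + x 0 * x 1) * M.e ℓ) / μ *
            (μ ^ 2 * x 1 / ((M.f ℓ + x 0 * x 1) ^ 2 * M.e ℓ * M.f ℓ)) =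
            μ / (M.f ℓ + x 0 * x 1) := by
        intro x hx
        rw [hf]
        field_simp
        ring
      have hd2 : (M.f ℓ + p 0 * p 1) ^ 2 * M.e ℓ * M.f ℓ ≠ 0 :=
        mul_ne_zero (mul_ne_zero (pow_ne_zero 2 hd) hen) hfn
      -- U is t/(μ/o - μ/e) with the factor o - e cancelled, so it stays regular when o = e; V is
      -- (μ/o - μ/f)/U.
      refine Lifts.second ℓ (U := fun x => -(x 0 * (M.f ℓ + x 0 * x 1) * M.e ℓ) / μ)
        (V := fun x => μ ^ 2 * x 1 / ((M.f ℓ + x 0 * x 1) ^ 2 * M.e ℓ * M.f ℓ))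
        (by fun_prop (disch := assumption)) (by fun_prop (disch := assumption)) ?_ ?_
      · rw [hE p hd]
        exact div_ne_zero hμ hd
      · filter_upwards [hd'] with x hx _
        rw [hE x hx, Model.param, hφ]
        simp only [Model.t, Model.o]
        congr 1
        rw [he]
        field_simp
        ring
  have hy : ∀ ℓ ℓ' : Line, ∀ ν : ℂ, ν ≠ 0 →
      (∀ t o, invFun μ (ℓ.pt t o) = ℓ'.pt (t / ν) o) → M'.e ℓ' = M.e ℓ →
      M'.f ℓ' = M.f ℓ → ∀ b, ∀ p ∈ M.dom ℓ b, Lifts M' (invFun μ) torus (M.param ℓ b) p := by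
    intro ℓ ℓ' ν hν hφ he hf b p hp
    cases b with
    | false =>
      have hE : ∀ x : Plane, M'.e ℓ' + x 0 / ν * (ν * x 1) = M.e ℓ + x 0 * x 1 := by
        intro x
        rw [he]
        field_simp
      refine Lifts.first ℓ' (T := fun x => x 0 / ν) (U := fun x => ν * x 1)
        (by fun_prop (disch := assumption)) (by fun_prop) ?_ (Eventually.of_forall fun x _ => ?_)
      · rw [hE]
        exact hp
      · rw [hE, Model.param, hφ]
        rfl
    | true =>
      have hE : ∀ x : Plane, M'.f ℓ' + x 0 / ν * (ν * x 1) = M.f ℓ + x 0 * x 1 := by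
        intro x
        rw [hf]
        field_simp
      refine Lifts.second ℓ' (U := fun x => x 0 / ν) (V := fun x => ν * x 1)
        (by fun_prop (disch := assumption)) (by fun_prop) ?_ (Eventually.of_forall fun x _ => ?_)
      · rw [hE]
        exact hp
      · rw [hE, Model.param, hφ, he]
        simp only [Model.t, Model.o]
        congr 1
        ring
  have hy0 := hy .y0 .yi μ hμ (fun t o => by simp [invFun, Line.pt]) h3 h4
  refine Reg.of_charts (hy0 false) fun ℓ b p hp ht => ?_
  cases ℓ with
  | y0 => exact hy0 b p hp
  | yi =>
    exact hy .yi .y0 μ⁻¹ (inv_ne_zero hμ)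
      (fun t o => by simp [invFun, Line.pt, mul_comm]) h1 h2 b p hp
  | x0 => exact key .x0 (fun t o => by simp [invFun, Line.pt]) h5 h6 b p hp ht
  | xi => exact key .xi (fun t o => by simp [invFun, Line.pt]) h7 h8 b p hp ht

lemma ModelIso.inv {M M' : Model} {μ : ℂ} (hμ : μ ≠ 0)
    (h1 : M'.e .y0 = M.e .yi) (h2 : M'.f .y0 = M.f .yi)
    (h3 : M'.e .yi = M.e .y0) (h4 : M'.f .yi = M.f .y0)
    (h5 : M'.e .x0 = μ / M.e .x0) (h6 : M'.f .x0 = μ / M.f .x0)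
    (h7 : M'.e .xi = μ / M.e .xi) (h8 : M'.f .xi = μ / M.f .xi) :
    ModelIso M M' (invEquiv μ hμ) where
  birational := isBirational_invEquiv μ hμ
  source_subset := subset_rfl
  target_subset := subset_rfl
  reg := Model.reg_inv hμ h1 h2 h3 h4 h5 h6 h7 h8
  reg_symm := by
    have e1 := M.e_ne .x0
    have e2 := M.f_ne .x0
    have e3 := M.e_ne .xi
    have e4 := M.f_ne .xi
    refine Model.reg_inv hμ h3.symm h4.symm h1.symm h2.symm ?_ ?_ ?_ ?_
    · rw [h5]; field_simp
    · rw [h6]; field_simp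
    · rw [h7]; field_simp
    · rw [h8]; field_simp

/-! #### The elementary transformation -/

/-- The map `(y, ξ) ↦ (y (ξ - α) / (ξ - β), ξ)`. -/
def elemFun (α β : ℂ) (x : Plane) : Plane := ![x 0 * (x 1 - α) / (x 1 - β), x 1]

/-- The domain of the elementary transformation. -/
def elemDom (α β : ℂ) : Set Plane := {x | x 0 ≠ 0 ∧ x 1 ≠ 0 ∧ x 1 ≠ α ∧ x 1 ≠ β}

lemma elemDom_comm (α β : ℂ) : elemDom α β = elemDom β α := by
  ext x
  simp only [elemDom, Set.mem_ofPred_eq]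
  tauto

lemma elemFun_mem {α β : ℂ} {x : Plane} (hx : x ∈ elemDom α β) : elemFun α β x ∈ elemDom α β :=
  ⟨div_ne_zero (mul_ne_zero hx.1 (sub_ne_zero.2 hx.2.2.1)) (sub_ne_zero.2 hx.2.2.2), hx.2⟩

lemma elemFun_elemFun {α β : ℂ} {x : Plane} (hx : x ∈ elemDom α β) :
    elemFun β α (elemFun α β x) = x := plane_ext (by
  have h1 := sub_ne_zero.2 hx.2.2.1
  have h2 := sub_ne_zero.2 hx.2.2.2
  simp only [elemFun, Matrix.cons_val_zero, Matrix.cons_val_one]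
  field_simp) rfl

/-- The map `(y, ξ) ↦ (y (ξ - α) / (ξ - β), ξ)` on an open subset of the torus. -/
def elemEquiv (α β : ℂ) : PartialEquiv Plane Plane where
  toFun := elemFun α β
  invFun := elemFun β α
  source := elemDom α β
  target := elemDom α β
  map_source' := fun _ hx => elemFun_mem hx
  map_target' := fun _ hx => by
    rw [elemDom_comm] at hx ⊢
    exact elemFun_mem hx
  left_inv' := fun x hx => elemFun_elemFun hx
  right_inv' := fun x hx => elemFun_elemFun (elemDom_comm α β ▸ hx)

lemma elemDom_mem_zGen (α β : ℂ) : elemDom α β ∈ zGen :=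
  inter_mem (mem_zGen_of_coord_ne 0 0) (inter_mem (mem_zGen_of_coord_ne 1 0)
    (inter_mem (mem_zGen_of_coord_ne 1 α) (mem_zGen_of_coord_ne 1 β)))

lemma isBirational_elemEquiv (α β : ℂ) : IsBirational (elemEquiv α β) := by
  have h : ∀ α β, ∀ p ∈ elemDom α β, RatMapAt (elemFun α β) p := fun α β p hp => by
    have := sub_ne_zero.2 hp.2.2.2
    refine RatMapAt.mk ?_ ?_ <;> fun_prop (disch := assumption)
  exact ⟨elemDom_mem_zGen α β, elemDom_mem_zGen α β, h α β, fun p hp => h β α p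
    (elemDom_comm α β ▸ hp)⟩

/-- The exceptional curve over (0, β) becomes the fibre ξ = β, and the old fibre ξ = β becomes the
exceptional curve over (∞, β); likewise at α with 0 and ∞ exchanged. Hence the first centres on y =
0 and y = ∞ trade values. The second ones stay, because y'/(ξ - α) = y/(ξ - β) makes the second
charts agree. Near ξ = 0 and ξ = ∞ the map multiplies y by a unit, with value α/β and 1
respectively. -/
lemma Model.reg_elem {M M' : Model} {α β : ℂ} (hα : M.e .yi = α) (hβ : M.e .y0 = β)
    (hne : α ≠ β)
    (h1 : M'.e .y0 = α) (h2 : M'.f .y0 = M.f .y0) (h3 : M'.e .yi = β) (h4 : M'.f .yi = M.f .yi)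
    (h5 : M'.e .x0 = α / β * M.e .x0) (h6 : M'.f .x0 = α / β * M.f .x0)
    (h7 : M'.e .xi = M.e .xi) (h8 : M'.f .xi = M.f .xi) :
    Reg M M' (elemFun α β) (elemDom α β) := by
  have hα0 : α ≠ 0 := hα ▸ M.e_ne _
  have hβ0 : β ≠ 0 := hβ ▸ M.e_ne _
  have hy0 : ∀ p ∈ M.dom .y0 false, Lifts M' (elemFun α β) (elemDom α β) (M.param .y0 false) p := by
    intro p hp
    have hp' : β + p 0 * p 1 ≠ 0 := hβ ▸ hp
    -- Here ξ - β = y x₁, so y' = (ξ - α)/x₁. For x₁ ≠ 0 this is a first-chart point at (0, α); for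
    -- x₁ = 0 the image is near y' = ∞, where 1/y' = x₁/(ξ - α) and (ξ - β)y' = y(ξ - α).
    by_cases hu : p 1 = 0
    · have hd : β + p 0 * p 1 - α ≠ 0 := by
        rw [hu, mul_zero, add_zero]
        exact sub_ne_zero.2 hne.symm
      have hE : ∀ x : Plane, β + x 0 * x 1 - α ≠ 0 →
          M'.e .yi + x 1 / (β + x 0 * x 1 - α) * (x 0 * (β + x 0 * x 1 - α)) = β + x 0 * x 1 := by
        intro x hx
        rw [h3, div_mul_eq_mul_div, ← mul_assoc, mul_div_assoc, div_self hx]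
        ring
      refine Lifts.first .yi (T := fun x => x 1 / (β + x 0 * x 1 - α))
        (U := fun x => x 0 * (β + x 0 * x 1 - α)) (by fun_prop (disch := assumption))
        (by fun_prop) (by rwa [hE p hd]) ?_
      filter_upwards [RatAt.eventually_ne (f := fun x => β + x 0 * x 1 - α) (by fun_prop) hd]
        with x hx hS
      rw [hE x hx]
      simp only [Model.param, Model.t, Model.o, Line.pt, elemDom, elemFun, Set.mem_ofPred_eq,
        Matrix.cons_val_zero, Matrix.cons_val_one, hβ] at hS ⊢
      obtain ⟨s1, -, -, s4⟩ := hS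
      congr 1
      have : x 1 ≠ 0 := by
        rintro h
        simp [h] at s4
      rw [add_sub_cancel_left]
      field_simp
    · have hE : ∀ x : Plane, x 1 ≠ 0 →
          M'.e .y0 + (β + x 0 * x 1 - α) / x 1 * x 1 = β + x 0 * x 1 := by
        intro x hx
        rw [h1]
        field_simp
        ring
      refine Lifts.first .y0 (T := fun x => (β + x 0 * x 1 - α) / x 1)
        (U := fun x => x 1) (by fun_prop (disch := assumption))
        (by fun_prop) (by rwa [hE p hu]) ?_
      filter_upwards [(RatAt.coord 1).eventually_ne hu] with x hx hS
      rw [hE x hx]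
      simp only [Model.param, Model.t, Model.o, Line.pt, elemDom, elemFun, Set.mem_ofPred_eq,
        Matrix.cons_val_zero, Matrix.cons_val_one, hβ] at hS ⊢
      obtain ⟨s1, -, -, s4⟩ := hS
      congr 1
      rw [add_sub_cancel_left]
      field_simp
  have hyi : ∀ p ∈ M.dom .yi false, Lifts M' (elemFun α β) (elemDom α β) (M.param .yi false) p := by
    intro p hp
    have hp' : α + p 0 * p 1 ≠ 0 := hα ▸ hp
    by_cases hu : p 1 = 0
    · have hd : α + p 0 * p 1 - β ≠ 0 := by
        rw [hu, mul_zero, add_zero]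
        exact sub_ne_zero.2 hne
      have hE : ∀ x : Plane, α + x 0 * x 1 - β ≠ 0 →
          M'.e .y0 + x 1 / (α + x 0 * x 1 - β) * (x 0 * (α + x 0 * x 1 - β)) = α + x 0 * x 1 := by
        intro x hx
        rw [h1, div_mul_eq_mul_div, ← mul_assoc, mul_div_assoc, div_self hx]
        ring
      refine Lifts.first .y0 (T := fun x => x 1 / (α + x 0 * x 1 - β))
        (U := fun x => x 0 * (α + x 0 * x 1 - β)) (by fun_prop (disch := assumption))
        (by fun_prop) (by rwa [hE p hd]) ?_
      filter_upwards [RatAt.eventually_ne (f := fun x => α + x 0 * x 1 - β) (by fun_prop) hd]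
        with x hx hS
      rw [hE x hx]
      simp only [Model.param, Model.t, Model.o, Line.pt, elemDom, elemFun, Set.mem_ofPred_eq,
        Matrix.cons_val_zero, Matrix.cons_val_one, hα] at hS ⊢
      obtain ⟨s1, -, s3, s4⟩ := hS
      congr 1
      have : x 0 ≠ 0 := by
        rintro h
        simp [h] at s1
      rw [add_sub_cancel_left]
      field_simp
    · have hE : ∀ x : Plane, x 1 ≠ 0 →
          M'.e .yi + (α + x 0 * x 1 - β) / x 1 * x 1 = α + x 0 * x 1 := by
        intro x hx
        rw [h3]
        field_simp
        ring
      refine Lifts.first .yi (T := fun x => (α + x 0 * x 1 - β) / x 1)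
        (U := fun x => x 1) (by fun_prop (disch := assumption))
        (by fun_prop) (by rwa [hE p hu]) ?_
      filter_upwards [(RatAt.coord 1).eventually_ne hu] with x hx hS
      rw [hE x hx]
      simp only [Model.param, Model.t, Model.o, Line.pt, elemDom, elemFun, Set.mem_ofPred_eq,
        Matrix.cons_val_zero, Matrix.cons_val_one, hα] at hS ⊢
      obtain ⟨s1, -, -, s4⟩ := hS
      congr 1
      have : x 0 ≠ 0 := by
        rintro h
        simp [h] at s1
      rw [add_sub_cancel_left, inv_div]
      field_simp
  refine Reg.of_charts hy0 fun ℓ b p hp ht => ?_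
  cases ℓ with
  | y0 =>
    cases b with
    | false => exact hy0 p hp
    | true =>
      refine Lifts.second .y0 (RatAt.coord 0) (RatAt.coord 1) (by rwa [h2])
        (Eventually.of_forall fun x hS => ?_)
      simp only [Model.param, Model.t, Model.o, Line.pt, elemDom, elemFun, Set.mem_ofPred_eq,
        Matrix.cons_val_zero, Matrix.cons_val_one, hβ, h1, h2] at hS ⊢
      have := sub_ne_zero.2 hS.2.2.2
      congr 1
      field_simp
  | yi =>
    cases b with
    | false => exact hyi p hp
    | true =>
      refine Lifts.second .yi (RatAt.coord 0) (RatAt.coord 1) (by rwa [h4])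
        (Eventually.of_forall fun x hS => ?_)
      simp only [Model.param, Model.t, Model.o, Line.pt, elemDom, elemFun, Set.mem_ofPred_eq,
        Matrix.cons_val_zero, Matrix.cons_val_one, hα, h3, h4] at hS ⊢
      have s3 := sub_ne_zero.2 hS.2.2.1
      have s4 := sub_ne_zero.2 hS.2.2.2
      have s1 : x 0 ≠ 0 := by
        rintro h
        simp [h] at hS
      congr 1
      field_simp
  | x0 =>
    have hd : β * (M.t .x0 b p - β) ≠ 0 := by
      rw [ht, zero_sub]
      exact mul_ne_zero hβ0 (neg_ne_zero.2 hβ0)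
    refine Lifts.of_unit .x0 (div_ne_zero hα0 hβ0) h5 h6 hp ht
      -- From (ξ - α)/(ξ - β) = α/β + ξ(β - α)/(β(ξ - β)).
      (g := fun x => (β - α) / (β * (M.t .x0 b x - β))) (by fun_prop (disch := assumption)) ?_
    intro x hS
    simp only [Model.param, Line.pt, elemDom, elemFun, Set.mem_ofPred_eq,
        Matrix.cons_val_zero, Matrix.cons_val_one] at hS ⊢
    have s4 := sub_ne_zero.2 hS.2.2.2
    congr 1
    field_simp
    ring
  | xi =>
    have hd : 1 - β * M.t .xi b p ≠ 0 := by simp [ht]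
    refine Lifts.of_unit .xi one_ne_zero (by rw [h7, one_mul]) (by rw [h8, one_mul]) hp ht
      -- From (ξ - α)/(ξ - β) = 1 + t(β - α)/(1 - βt), where ξ = 1/t.
      (g := fun x => (β - α) / (1 - β * M.t .xi b x)) (by fun_prop (disch := assumption)) ?_
    intro x hS
    simp only [Model.param, Line.pt, elemDom, elemFun, Set.mem_ofPred_eq,
        Matrix.cons_val_zero, Matrix.cons_val_one] at hS ⊢
    have s4 := sub_ne_zero.2 hS.2.2.2
    have s2 : M.t .xi b x ≠ 0 := fun h => hS.2.1 (by rw [h, inv_zero])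
    have s5 : 1 - β * M.t .xi b x ≠ 0 := by
      intro h
      apply s4
      field_simp
      linear_combination h
    congr 1
    rw [div_eq_iff s4]
    generalize M.t .xi b x = τ at *
    have s6 : τ⁻¹ - β = (1 - β * τ) / τ := by field_simp
    rw [s6]
    obtain ⟨D, hD⟩ : ∃ D, D = 1 - β * τ := ⟨_, rfl⟩
    rw [← hD] at s5 ⊢
    field_simp
    rw [hD]
    ring

/-- If α = β the transformation is the identity and the model does not change. This degenerate case
must be admitted, since the intermediate parameters are not controlled. -/
lemma ModelIso.elem {M M' : Model} {α β : ℂ} (hα : M.e .yi = α) (hβ : M.e .y0 = β)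
    (h1 : M'.e .y0 = α) (h2 : M'.f .y0 = M.f .y0) (h3 : M'.e .yi = β) (h4 : M'.f .yi = M.f .yi)
    (h5 : M'.e .x0 = α / β * M.e .x0) (h6 : M'.f .x0 = α / β * M.f .x0)
    (h7 : M'.e .xi = M.e .xi) (h8 : M'.f .xi = M.f .xi) :
    ModelIso M M' (elemEquiv α β) := by
  have hα0 : α ≠ 0 := hα ▸ M.e_ne _
  have hβ0 : β ≠ 0 := hβ ▸ M.e_ne _
  have hsub : elemDom α β ⊆ torus := fun x hx => ⟨hx.1, hx.2.1⟩
  refine ⟨isBirational_elemEquiv α β, hsub, hsub, ?_, ?_⟩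
  · by_cases hne : α = β
    · have : M' = M := by
        subst hne
        rw [div_self hα0, one_mul] at h5 h6
        cases M
        cases M'
        simp only [Model.mk.injEq]
        constructor <;> ext ℓ <;> cases ℓ <;> simp_all
      subst this
      refine Model.reg_refl fun x hx => ?_
      have := sub_ne_zero.2 hx.2.2.2
      subst hne
      refine plane_ext ?_ rfl
      simp only [elemEquiv, elemFun, Matrix.cons_val_zero]
      field_simp
    · exact Model.reg_elem hα hβ hne h1 h2 h3 h4 h5 h6 h7 h8
  · by_cases hne : α = β
    · have : M' = M := by
        subst hne
        rw [div_self hα0, one_mul] at h5 h6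
        cases M
        cases M'
        simp only [Model.mk.injEq]
        constructor <;> ext ℓ <;> cases ℓ <;> simp_all
      subst this
      refine Model.reg_refl fun x hx => ?_
      have := sub_ne_zero.2 hx.2.2.2
      subst hne
      refine plane_ext ?_ rfl
      simp only [elemEquiv, elemFun, PartialEquiv.coe_symm_mk, Matrix.cons_val_zero]
      field_simp
    · have h := Model.reg_elem (M := M') (M' := M) h3 h1 (Ne.symm hne) hβ h2.symm hα h4.symm
        (by rw [h5]; field_simp) (by rw [h6]; field_simp) h7.symm h8.symm
      rw [elemDom_comm] at h
      exact h

end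

/-! ### The translation as a product of elementary isomorphisms -/

noncomputable section

lemma Model.tr_tr (M : Model) : M.tr.tr = M := by
  cases M
  simp only [Model.tr, Model.mk.injEq]
  constructor <;> ext ℓ <;> cases ℓ <;> rfl

lemma ModelIso.invX {M M' : Model} {μ : ℂ} (hμ : μ ≠ 0)
    (h1 : M'.e .x0 = M.e .xi) (h2 : M'.f .x0 = M.f .xi)
    (h3 : M'.e .xi = M.e .x0) (h4 : M'.f .xi = M.f .x0)
    (h5 : M'.e .y0 = μ / M.e .y0) (h6 : M'.f .y0 = μ / M.f .y0)
    (h7 : M'.e .yi = μ / M.e .yi) (h8 : M'.f .yi = μ / M.f .yi) :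
    ModelIso M M' (conjSwap (invEquiv μ hμ)) := by
  have h := (ModelIso.inv (M := M.tr) (M' := M'.tr) hμ h1 h2 h3 h4 h5 h6 h7 h8).tr
  rwa [Model.tr_tr, Model.tr_tr] at h

lemma ModelIso.elemX {M M' : Model} {α β : ℂ} (hα : M.e .xi = α) (hβ : M.e .x0 = β)
    (h1 : M'.e .x0 = α) (h2 : M'.f .x0 = M.f .x0) (h3 : M'.e .xi = β) (h4 : M'.f .xi = M.f .xi)
    (h5 : M'.e .y0 = α / β * M.e .y0) (h6 : M'.f .y0 = α / β * M.f .y0)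
    (h7 : M'.e .yi = M.e .yi) (h8 : M'.f .yi = M.f .yi) :
    ModelIso M M' (conjSwap (elemEquiv α β)) := by
  have h := (ModelIso.elem (M := M.tr) (M' := M'.tr) hα hβ h1 h2 h3 h4 h5 h6 h7 h8).tr
  rwa [Model.tr_tr, Model.tr_tr] at h

/-- The surface with the given pairs of centres on the lines `y = 0`, `y = ∞`, `ξ = 0`, `ξ = ∞`. -/
def Model.of (a₁ a₂ b₁ b₂ c₁ c₂ d₁ d₂ : ℂ) (ha₁ : a₁ ≠ 0) (ha₂ : a₂ ≠ 0) (hb₁ : b₁ ≠ 0)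
    (hb₂ : b₂ ≠ 0) (hc₁ : c₁ ≠ 0) (hc₂ : c₂ ≠ 0) (hd₁ : d₁ ≠ 0) (hd₂ : d₂ ≠ 0) : Model where
  e := fun ℓ => match ℓ with
    | .y0 => a₁
    | .yi => b₁
    | .x0 => c₁
    | .xi => d₁
  f := fun ℓ => match ℓ with
    | .y0 => a₂
    | .yi => b₂
    | .x0 => c₂
    | .xi => d₂
  e_ne := by rintro (_ | _ | _ | _) <;> assumption
  f_ne := by rintro (_ | _ | _ | _) <;> assumption

/-- The relation between a point `(y, ξ)` and its image `(y', ξ')`, and an intermediate value `η`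
of the first coordinate, for the translation `(b₅, b₇) ↦ (b₅ / q, b₇ / q)`. -/
structure TranslationRel (q b₅ b₆ b₇ b₈ c₁ c₂ c₃ c₄ y ξ η y' ξ' : ℂ) : Prop where
  y_ne : y ≠ 0
  ξ_ne : ξ ≠ 0
  ξ_ne₈ : ξ - b₈ ≠ 0
  η_ne₃ : η - c₃ ≠ 0
  η_ne₄ : η - c₄ ≠ 0
  ξ'_ne : ξ' ≠ 0
  ξ'_ne₇ : ξ' - b₇ / q ≠ 0
  y'_ne : y' ≠ 0
  η_eq : η = c₃ * c₄ * (ξ - b₅) / ((ξ - b₈) * y)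
  ξ'_eq : ξ' = b₆ * b₈ / ξ * (η - c₃ * c₄ * b₅ / (b₈ * c₁)) * (η - c₃ * c₄ * b₅ / (b₈ * c₂)) /
    ((η - c₃) * (η - c₄))
  y'_eq : y' = η * (ξ' - b₆) / (ξ' - b₇ / q)

/-- The steps `i1`, `i2` replace y by η; `i3` to `i7` replace ξ by ξ', one elementary transformation
for each factor (η - d₁)/(η - c₄) and (η - d₂)/(η - c₃); `i8` replaces η by y'. Elementary
transformations act on the first centre of a pair, whence the reorderings `i5`, `i6`. The values d₁,
d₂ are what c₁, c₂ become under `i1` and `i2`. The relation between the parameters enters in `i7`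
and `i8`, where the centres have to come out as those of the shifted surface. -/
lemma exists_modelIso {q b₅ b₆ b₇ b₈ c₁ c₂ c₃ c₄ : ℂ} (hq : q ≠ 0) (h₅ : b₅ ≠ 0) (h₆ : b₆ ≠ 0)
    (h₇ : b₇ ≠ 0) (h₈ : b₈ ≠ 0) (h₁ : c₁ ≠ 0) (h₂ : c₂ ≠ 0) (h₃ : c₃ ≠ 0) (h₄ : c₄ ≠ 0)
    (hrel : b₅ * b₆ * q * c₃ * c₄ = b₇ * b₈ * c₁ * c₂) :
    ∃ e, ModelIso
      (Model.of b₅ b₆ b₈ b₇ c₁ c₂ c₃ c₄ h₅ h₆ h₈ h₇ h₁ h₂ h₃ h₄)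
      (Model.of b₆ (b₅ / q) (b₇ / q) b₈ c₁ c₂ c₃ c₄ h₆ (div_ne_zero h₅ hq) (div_ne_zero h₇ hq) h₈
        h₁ h₂ h₃ h₄) e ∧
      ∀ x ∈ e.source, ∃ η,
        TranslationRel q b₅ b₆ b₇ b₈ c₁ c₂ c₃ c₄ (x 0) (x 1) η (e x 0) (e x 1) := by
  set d₁ := c₃ * c₄ * b₅ / (b₈ * c₁) with hd₁
  set d₂ := c₃ * c₄ * b₅ / (b₈ * c₂) with hd₂
  have h34 : c₃ * c₄ ≠ 0 := mul_ne_zero h₃ h₄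
  have h68 : b₆ * b₈ ≠ 0 := mul_ne_zero h₆ h₈
  have hd₁0 : d₁ ≠ 0 := by positivity
  have hd₂0 : d₂ ≠ 0 := by positivity
  have i1 : ModelIso (Model.of b₅ b₆ b₈ b₇ c₁ c₂ c₃ c₄ h₅ h₆ h₈ h₇ h₁ h₂ h₃ h₄)
      (Model.of b₈ b₆ b₅ b₇ (b₈ / b₅ * c₁) (b₈ / b₅ * c₂) c₃ c₄ h₈ h₆ h₅ h₇
        (by positivity) (by positivity) h₃ h₄) (elemEquiv b₈ b₅) :=
    ModelIso.elem rfl rfl rfl rfl rfl rfl rfl rfl rfl rfl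
  have i2 : ModelIso (Model.of b₈ b₆ b₅ b₇ (b₈ / b₅ * c₁) (b₈ / b₅ * c₂) c₃ c₄ h₈ h₆ h₅ h₇
        (by positivity) (by positivity) h₃ h₄)
      (Model.of b₅ b₇ b₈ b₆ d₁ d₂ c₄ c₃ h₅ h₇ h₈ h₆ hd₁0 hd₂0 h₄ h₃) (invEquiv (c₃ * c₄) h34) := by
    refine ModelIso.inv h34 rfl rfl rfl rfl ?_ ?_ ?_ ?_ <;> simp only [Model.of, hd₁, hd₂] <;>
      field_simp
  have i3 : ModelIso (Model.of b₅ b₇ b₈ b₆ d₁ d₂ c₄ c₃ h₅ h₇ h₈ h₆ hd₁0 hd₂0 h₄ h₃)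
      (Model.of (b₆ * b₈ / b₅) (b₆ * b₈ / b₇) b₆ b₈ c₄ c₃ d₁ d₂ (by positivity) (by positivity)
        h₆ h₈ h₄ h₃ hd₁0 hd₂0) (conjSwap (invEquiv (b₆ * b₈) h68)) := by
    refine ModelIso.invX h68 rfl rfl rfl rfl rfl rfl ?_ ?_ <;> simp only [Model.of] <;>
      field_simp
  have i4 : ModelIso (Model.of (b₆ * b₈ / b₅) (b₆ * b₈ / b₇) b₆ b₈ c₄ c₃ d₁ d₂ (by positivity)
        (by positivity) h₆ h₈ h₄ h₃ hd₁0 hd₂0)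
      (Model.of (d₁ / c₄ * (b₆ * b₈ / b₅)) (d₁ / c₄ * (b₆ * b₈ / b₇)) b₆ b₈ d₁ c₃ c₄ d₂
        (by positivity) (by positivity) h₆ h₈ hd₁0 h₃ h₄ hd₂0) (conjSwap (elemEquiv d₁ c₄)) :=
    ModelIso.elemX rfl rfl rfl rfl rfl rfl rfl rfl rfl rfl
  have i5 : ModelIso (Model.of (d₁ / c₄ * (b₆ * b₈ / b₅)) (d₁ / c₄ * (b₆ * b₈ / b₇)) b₆ b₈
        d₁ c₃ c₄ d₂ (by positivity) (by positivity) h₆ h₈ hd₁0 h₃ h₄ hd₂0)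
      (Model.of (d₁ / c₄ * (b₆ * b₈ / b₅)) (d₁ / c₄ * (b₆ * b₈ / b₇)) b₆ b₈
        c₃ d₁ c₄ d₂ (by positivity) (by positivity) h₆ h₈ h₃ hd₁0 h₄ hd₂0) torusRefl := by
    refine ModelIso.swap .x0 rfl rfl ?_ ?_ <;> rintro (_ | _ | _ | _) h <;> first | rfl | simp at h
  have i6 : ModelIso (Model.of (d₁ / c₄ * (b₆ * b₈ / b₅)) (d₁ / c₄ * (b₆ * b₈ / b₇)) b₆ b₈
        c₃ d₁ c₄ d₂ (by positivity) (by positivity) h₆ h₈ h₃ hd₁0 h₄ hd₂0)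
      (Model.of (d₁ / c₄ * (b₆ * b₈ / b₅)) (d₁ / c₄ * (b₆ * b₈ / b₇)) b₆ b₈
        c₃ d₁ d₂ c₄ (by positivity) (by positivity) h₆ h₈ h₃ hd₁0 hd₂0 h₄) torusRefl := by
    refine ModelIso.swap .xi rfl rfl ?_ ?_ <;> rintro (_ | _ | _ | _) h <;> first | rfl | simp at h
  have i7 : ModelIso (Model.of (d₁ / c₄ * (b₆ * b₈ / b₅)) (d₁ / c₄ * (b₆ * b₈ / b₇)) b₆ b₈
        c₃ d₁ d₂ c₄ (by positivity) (by positivity) h₆ h₈ h₃ hd₁0 hd₂0 h₄)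
      (Model.of (b₇ / q) (b₅ / q) b₆ b₈ d₂ d₁ c₃ c₄ (by positivity) (by positivity) h₆ h₈
        hd₂0 hd₁0 h₃ h₄) (conjSwap (elemEquiv d₂ c₃)) := by
    refine ModelIso.elemX rfl rfl rfl rfl rfl rfl ?_ ?_ rfl rfl <;>
      simp only [Model.of, hd₁, hd₂] <;> field_simp <;> linear_combination -hrel
  have i8 : ModelIso (Model.of (b₇ / q) (b₅ / q) b₆ b₈ d₂ d₁ c₃ c₄ (by positivity)
        (by positivity) h₆ h₈ hd₂0 hd₁0 h₃ h₄)
      (Model.of b₆ (b₅ / q) (b₇ / q) b₈ c₁ c₂ c₃ c₄ h₆ (div_ne_zero h₅ hq) (div_ne_zero h₇ hq) h₈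
        h₁ h₂ h₃ h₄) (elemEquiv b₆ (b₇ / q)) := by
    refine ModelIso.elem rfl rfl rfl rfl rfl rfl ?_ ?_ rfl rfl <;>
      simp only [Model.of, hd₁, hd₂] <;> field_simp <;> linear_combination -hrel
  refine ⟨_, (((((((i1.trans i2).trans i3).trans i4).trans i5).trans i6).trans i7).trans i8), ?_⟩
  intro x hx
  simp only [PartialEquiv.trans_source, Set.mem_inter_iff, Set.mem_preimage,
    PartialEquiv.coe_trans, Function.comp, conjSwap, swapEquiv, elemEquiv, invEquiv, elemDom,
    torusRefl, PartialEquiv.ofSet_coe, PartialEquiv.ofSet_source, torus, elemFun, invFun,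
    Set.mem_ofPred_eq, id, swapCoord, Set.mem_univ, true_and, and_true,
    Matrix.cons_val_zero, Matrix.cons_val_one] at hx ⊢
  obtain ⟨η, hη⟩ : ∃ η, η = c₃ * c₄ / (x 0 * (x 1 - b₈) / (x 1 - b₅)) := ⟨_, rfl⟩
  rw [← hη] at hx ⊢
  obtain ⟨ξ', hξ'⟩ : ∃ ξ', ξ' = b₆ * b₈ / x 1 * (η - d₁) / (η - c₄) * (η - d₂) / (η - c₃) :=
    ⟨_, rfl⟩
  rw [← hξ'] at hx ⊢
  obtain ⟨⟨⟨⟨⟨⟨⟨⟨m1, m2, m3, m4⟩, -⟩, -⟩, -, m5, m6, m7⟩, -⟩, -⟩, -, -, m8, m9⟩, -, m10, m11, m12⟩ := hx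
  rw [← sub_ne_zero] at m3 m4 m6 m7 m8 m9 m11 m12
  refine ⟨η, ⟨m1, m2, m3, m9, m7, m10, m12, ?_, ?_, ?_, rfl⟩⟩
  · exact div_ne_zero (mul_ne_zero m5 m11) m12
  · rw [hη]
    field_simp
  · rw [hξ', ← hd₁, ← hd₂]
    field_simp

end

noncomputable section

/-! ### Charts of the blow-up -/

lemma ProjLine.chartAt_some (a t : ℂ) :
    ProjLine.chartAt (OnePoint.some a) t = OnePoint.some (a + t) := rfl

lemma ProjLine.chartAt_infty (t : ℂ) :
    ProjLine.chartAt ∞ t = if t = 0 then ∞ else OnePoint.some t⁻¹ := rfl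

lemma ProjLine.chartAt_zero (a : ProjLine) : ProjLine.chartAt a 0 = a := by
  induction a using OnePoint.rec with
  | infty => simp [chartAt_infty]
  | coe a => simp [chartAt_some]

/-- A rational map to the projective line with finite value is a rational function. -/
lemma ProjLine.chartAt_lift {a : ProjLine} {T : Plane → ℂ} {p : Plane} (hT : RatAt T p) {y : ℂ}
    (h : ProjLine.chartAt a (T p) = OnePoint.some y) :
    ∃ Y : Plane → ℂ, RatAt Y p ∧
      ∀ᶠ x in zNhds p, ProjLine.chartAt a (T x) = OnePoint.some (Y x) := by
  induction a using OnePoint.rec with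
  | coe a => exact ⟨fun x => a + T x, by fun_prop, Eventually.of_forall fun x => rfl⟩
  | infty =>
    have h0 : T p ≠ 0 := by
      intro h0
      simp [chartAt_infty, h0] at h
    refine ⟨fun x => (T x)⁻¹, by fun_prop (disch := assumption), ?_⟩
    filter_upwards [hT.eventually_ne h0] with x hx
    rw [chartAt_infty, if_neg hx]

/-- The projective line is separated. -/
lemma ProjLine.chartAt_eq_of_eventuallyEq {a a' : ProjLine} {T T' : Plane → ℂ} {p : Plane}
    (hT : RatAt T p) (hT' : RatAt T' p)
    (h : ∀ᶠ x in zGen, ProjLine.chartAt a (T x) = ProjLine.chartAt a' (T' x)) :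
    ProjLine.chartAt a (T p) = ProjLine.chartAt a' (T' p) := by
  -- Between a finite chart and the chart at infinity, generic equality says (b + S)S' = 1. This
  -- identity persists at p and excludes S' p = 0.
  have mixed : ∀ (b : ℂ) (S S' : Plane → ℂ), RatAt S p → RatAt S' p →
      (∀ᶠ x in zGen, ProjLine.chartAt (OnePoint.some b) (S x) = ProjLine.chartAt ∞ (S' x)) →
      ProjLine.chartAt (OnePoint.some b) (S p) = ProjLine.chartAt ∞ (S' p) := by
    intro b S S' hS hS' h
    have key : (b + S p) * S' p = 1 := by
      refine RatAt.eq_of_eventuallyEq (f := fun x => (b + S x) * S' x) (g := fun _ => 1)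
        (by fun_prop) (by fun_prop) (h.mono fun x hx => ?_)
      rw [chartAt_some, chartAt_infty] at hx
      split_ifs at hx with h0
      · simp at hx
      · rw [OnePoint.coe_eq_coe] at hx
        show (b + S x) * S' x = 1
        rw [hx, inv_mul_cancel₀ h0]
    have h0 : S' p ≠ 0 := right_ne_zero_of_mul_eq_one key
    rw [chartAt_some, chartAt_infty, if_neg h0, eq_inv_of_mul_eq_one_left key]
  induction a using OnePoint.rec with
  | coe a =>
    induction a' using OnePoint.rec with
    | coe a' =>
      have key : a + T p = a' + T' p := by
        refine RatAt.eq_of_eventuallyEq (f := fun x => a + T x) (g := fun x => a' + T' x)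
          (by fun_prop) (by fun_prop) (h.mono fun x hx => ?_)
        rwa [chartAt_some, chartAt_some, OnePoint.coe_eq_coe] at hx
      rw [chartAt_some, chartAt_some, key]
    | infty => exact mixed a T T' hT hT' h
  | infty =>
    induction a' using OnePoint.rec with
    | coe a' => exact (mixed a' T' T hT' hT (h.mono fun _ hx => hx.symm)).symm
    | infty =>
      have key : T p = T' p := by
        refine RatAt.eq_of_eventuallyEq hT hT' (h.mono fun x hx => ?_)
        rw [chartAt_infty, chartAt_infty] at hx
        split_ifs at hx with h0 h1 h1
        · rw [h0, h1]
        · simp at hx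
        · simp at hx
        · rwa [OnePoint.coe_eq_coe, inv_inj] at hx
      rw [key]

namespace BlowUp

variable {Z Z' : Set (ProjLine × ProjLine)}

lemma isOpen_iff_eventually {U : Set (BlowUp Z)} :
    IsOpen U ↔ ∀ (i : Chart Z) (p : i.dom), i.toPoint p ∈ U →
      ∀ᶠ x in zNhds (p : Plane), ∀ hx : x ∈ i.dom, i.toPoint ⟨x, hx⟩ ∈ U := by
  constructor
  · intro h i p hp
    obtain ⟨G, hG, h⟩ := h i p hp
    exact mem_zNhds.2 ⟨G, hG, fun x hx hxd => h ⟨x, hxd⟩ hx⟩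
  · intro h i p hp
    obtain ⟨G, hG, h⟩ := mem_zNhds.1 (h i p hp)
    exact ⟨G, hG, fun x hx => h x hx x.2⟩

/-- A map given by rational functions in charts is regular. -/
lemma isRegularMap_of_charts {U : Set (BlowUp Z)} {V : Set (BlowUp Z')} (hU : IsOpen U)
    (f : U → V) (h : ∀ (i : Chart Z) (p : i.dom), i.toPoint p ∈ U →
      ∃ (j : Chart Z') (g : Plane → Plane), RatMapAt g p ∧ ∀ᶠ x in zNhds (p : Plane),
        ∀ (hx : x ∈ i.dom) (hxU : i.toPoint ⟨x, hx⟩ ∈ U), ∃ hg : g x ∈ j.dom,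
          (f ⟨_, hxU⟩ : BlowUp Z') = j.toPoint ⟨g x, hg⟩) : IsRegularMap f := by
  constructor
  · refine continuous_def.2 fun W₀ hW₀ => ?_
    obtain ⟨W, hW, rfl⟩ := isOpen_induced_iff.1 hW₀
    refine isOpen_induced_iff.2 ⟨{x | ∃ hx : x ∈ U, (f ⟨x, hx⟩ : BlowUp Z') ∈ W}, ?_, ?_⟩
    · refine isOpen_iff_eventually.2 fun i p hp => ?_
      obtain ⟨hpU, hpW⟩ := hp
      obtain ⟨j, g, hg, h⟩ := h i p hpU
      obtain ⟨hgp, hfp⟩ := mem_of_mem_zNhds h p.2 hpU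
      rw [hfp] at hpW
      have hW' : ∀ᶠ x in zNhds (p : Plane), ∀ hx : g x ∈ j.dom, j.toPoint ⟨g x, hx⟩ ∈ W :=
        hg.tendsto.eventually (isOpen_iff_eventually.1 hW j ⟨g p, hgp⟩ hpW)
      filter_upwards [h, isOpen_iff_eventually.1 hU i p hpU, hW'] with x h1 h2 h3 hx
      obtain ⟨hgx, hfx⟩ := h1 hx (h2 hx)
      exact ⟨h2 hx, hfx ▸ h3 hgx⟩
    · ext x
      simp
  · intro W _ _ k hk i p hp
    obtain ⟨hpU, hpW⟩ := hp
    obtain ⟨j, g, hg, h⟩ := h i p hpU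
    obtain ⟨hgp, hfp⟩ := mem_of_mem_zNhds h p.2 hpU
    rw [hfp] at hpW
    obtain ⟨F, G, hG, hFG⟩ := hk j ⟨g p, hgp⟩ hpW
    have hr : RatAt (fun x => MvPolynomial.eval (g x) F / MvPolynomial.eval (g x) G) p :=
      (RatAt.eval_comp hg F).div (RatAt.eval_comp hg G) hG
    obtain ⟨F', G', hG', h'⟩ := hr.exists_eq_div
      (inter_mem h ((RatAt.eval_comp hg G).eventually_ne hG))
    refine ⟨F', G', hG', fun x hx hx0 => ?_⟩
    obtain ⟨⟨h1, h2⟩, h3⟩ := h' x hx0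
    obtain ⟨hxU, hxW⟩ := hx
    obtain ⟨hgx, hfx⟩ := h1 x.2 hxU
    rw [← h3, ← hFG ⟨g x, hgx⟩ (hfx ▸ hxW) h2]
    exact congrArg k (Subtype.ext (by exact hfx))

lemma ext_of_base {x x' : BlowUp Z} (h : x.base = x'.base) (hx : x.base ∉ Z) : x = x' := by
  obtain ⟨b, d⟩ := x
  obtain ⟨b', d'⟩ := x'
  obtain rfl : b = b' := h
  congr 1
  funext hb
  exact absurd hb hx

end BlowUp

/-! ### The charts at the centres -/

/-- The point of the line with coordinate `c`. -/
def Line.ctr : Line → ℂ → ProjLine × ProjLine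
  | .y0, c => (OnePoint.some 0, OnePoint.some c)
  | .yi, c => (∞, OnePoint.some c)
  | .x0, c => (OnePoint.some c, OnePoint.some 0)
  | .xi, c => (OnePoint.some c, ∞)

/-- The index of the coordinate that is constant along the line. -/
def Line.idx : Line → Fin 2
  | .y0 => 0
  | .yi => 0
  | .x0 => 1
  | .xi => 1

/-- The change from the coordinates `(t, u)` to the coordinates of the plane. -/
def Line.conv : Line → Plane → Plane
  | .y0, p => p
  | .yi, p => p
  | .x0, p => swapCoord p
  | .xi, p => swapCoord p

lemma Line.conv_conv (ℓ : Line) (p : Plane) : ℓ.conv (ℓ.conv p) = p := by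
  cases ℓ <;> simp [conv, swapCoord_swapCoord]

lemma Line.ratMapAt_conv (ℓ : Line) (p : Plane) : RatMapAt ℓ.conv p := by
  cases ℓ
  · exact RatMapAt.id
  · exact RatMapAt.id
  · exact ratMapAt_swapCoord p
  · exact ratMapAt_swapCoord p

lemma Line.conv_idx (ℓ : Line) (p : Plane) : ℓ.conv p ℓ.idx = p 0 := by
  cases ℓ <;> simp [conv, idx, swapCoord]

/-- The point with local coordinate `t` transversal to the line, and with other coordinate `o`. -/
def Line.base (ℓ : Line) (t o : ℂ) : ProjLine × ProjLine := quadricChart (ℓ.ctr 0) (ℓ.conv ![t, o])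

/-- The embedding of the affine plane. -/
def affineEmb (x : Plane) : ProjLine × ProjLine := (OnePoint.some (x 0), OnePoint.some (x 1))

lemma affineEmb_injective : Function.Injective affineEmb := by
  intro x y h
  simp only [affineEmb, Prod.mk.injEq, OnePoint.coe_eq_coe] at h
  exact plane_ext h.1 h.2

lemma Line.base_eq_affineEmb (ℓ : Line) {t : ℂ} (o : ℂ) (ht : t ≠ 0) :
    ℓ.base t o = affineEmb (ℓ.pt t o) := by
  cases ℓ <;> simp [base, ctr, conv, swapCoord, quadricChart, affineEmb, pt,
    ProjLine.chartAt_some, ProjLine.chartAt_infty, ht]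

lemma Line.base_zero (ℓ : Line) (o : ℂ) : ℓ.base 0 o = ℓ.ctr o := by
  cases ℓ <;> simp [base, ctr, conv, swapCoord, quadricChart,
    ProjLine.chartAt_some, ProjLine.chartAt_infty]

lemma Line.ctr_inj {ℓ ℓ' : Line} {c c' : ℂ} (hc' : c' ≠ 0)
    (h : ℓ.ctr c = ℓ'.ctr c') : ℓ = ℓ' ∧ c = c' := by
  cases ℓ <;> cases ℓ' <;> simp_all [ctr, eq_comm]

lemma Line.ctr_ne_affineEmb (ℓ : Line) (c : ℂ) {x : Plane} (hx : x ∈ torus) :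
    ℓ.ctr c ≠ affineEmb x := by
  have h0 := hx.1
  have h1 := hx.2
  intro h
  cases ℓ <;> simp_all [ctr, affineEmb, eq_comm]

/-- The first chart of the blow-up at the point `c` of a line: the coordinates are
`(t, (o - c) / t)`. -/
def Line.first (ℓ : Line) (c : ℂ) (p : Plane) : Plane := ℓ.pt (p 0) (c + p 0 * p 1)

/-- The coordinates of the first chart. -/
def Line.firstInv (ℓ : Line) (c : ℂ) (x : Plane) : Plane :=
  match ℓ with
  | .y0 => ![x 0, (x 1 - c) / x 0]
  | .yi => ![(x 0)⁻¹, (x 1 - c) / (x 0)⁻¹]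
  | .x0 => ![x 1, (x 0 - c) / x 1]
  | .xi => ![(x 1)⁻¹, (x 0 - c) / (x 1)⁻¹]

/-- The first chart, as an equivalence with the torus. -/
def Line.firstEquiv (ℓ : Line) (c : ℂ) : PartialEquiv Plane Plane where
  toFun := ℓ.first c
  invFun := ℓ.firstInv c
  source := {p | p 0 ≠ 0 ∧ c + p 0 * p 1 ≠ 0}
  target := torus
  map_source' := fun _ hp => Line.pt_mem_torus.2 hp
  map_target' := fun x hx => by
    have h0 := hx.1
    have h1 := hx.2
    cases ℓ <;> simp [firstInv] <;> field_simp <;> simp [h0, h1]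
  left_inv' := fun p hp => by
    have h0 := hp.1
    cases ℓ <;> refine plane_ext ?_ ?_ <;> simp [first, firstInv, pt] <;> field_simp
  right_inv' := fun x hx => by
    have h0 := hx.1
    have h1 := hx.2
    cases ℓ <;> refine plane_ext ?_ ?_ <;> simp [first, firstInv, pt] <;> field_simp <;> ring

lemma Line.isBirational_firstEquiv (ℓ : Line) (c : ℂ) : IsBirational (ℓ.firstEquiv c) where
  source_mem := by
    refine inter_mem (mem_zGen_of_coord_ne 0 0) (mem_zGen.2
      ⟨.C c + .X 0 * .X 1, fun h => ?_, fun x hx => ?_⟩)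
    · have h1 := congrArg (MvPolynomial.eval 0) h
      have h2 := congrArg (MvPolynomial.eval 1) h
      simp at h1 h2
      simp [h1] at h2
    · show c + x 0 * x 1 ≠ 0
      simpa using hx
  target_mem := torus_mem_zGen
  rat := by
    intro p hp
    have h0 := hp.1
    cases ℓ <;> refine RatMapAt.mk ?_ ?_ <;> fun_prop (disch := assumption)
  rat_symm := by
    intro p hp
    have h0 := hp.1
    have h1 := hp.2
    have h0' := inv_ne_zero h0
    have h1' := inv_ne_zero h1
    cases ℓ <;> refine RatMapAt.mk ?_ ?_ <;> fun_prop (disch := assumption)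

/-- The point of the blow-up with coordinates `p` in the first chart at the point `c` of a line. -/
def Line.point (Z : Set (ProjLine × ProjLine)) (ℓ : Line) (c : ℂ) (p : Plane) : BlowUp Z :=
  ⟨quadricChart (ℓ.ctr c) (BlowUp.quadraticMap ℓ.idx (ℓ.conv p)), fun _ =>
    Projectivization.mk ℂ (Function.update (ℓ.conv p) ℓ.idx 1) (BlowUp.update_one_ne_zero _ _)⟩

lemma Line.point_base (Z : Set (ProjLine × ProjLine)) (ℓ : Line) (c : ℂ) (p : Plane) :
    (ℓ.point Z c p).base = ℓ.base (p 0) (c + p 0 * p 1) := by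
  cases ℓ <;> simp [point, base, ctr, conv, idx, swapCoord, quadricChart, BlowUp.quadraticMap,
    ProjLine.chartAt_some, ProjLine.chartAt_infty]

end

/-! ### First charts inside the blow-up -/

noncomputable section

/-- The coordinate `c` belongs to one of the two centres on the line. -/
def Model.IsVal (M : Model) (ℓ : Line) (c : ℂ) : Prop := c = M.e ℓ ∨ c = M.f ℓ

lemma Model.IsVal.ne_zero {M : Model} {ℓ : Line} {c : ℂ} (h : M.IsVal ℓ c) : c ≠ 0 := by
  rcases h with rfl | rfl
  · exact M.e_ne ℓ
  · exact M.f_ne ℓ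

/-- The set of the eight centres. -/
def Model.ctrs (M : Model) : Set (ProjLine × ProjLine) :=
  {z | ∃ ℓ c, M.IsVal ℓ c ∧ z = ℓ.ctr c}

variable {M : Model}

lemma Model.affineEmb_notMem_ctrs {x : Plane} (hx : x ∈ torus) : affineEmb x ∉ M.ctrs := by
  rintro ⟨ℓ, c, -, h⟩
  exact ℓ.ctr_ne_affineEmb c hx h.symm

namespace Line

variable (Z : Set (ProjLine × ProjLine)) (ℓ : Line) (c : ℂ) {p : Plane}

lemma point_base_of_ne (hp : p 0 ≠ 0) : (ℓ.point Z c p).base = affineEmb (ℓ.first c p) := by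
  rw [point_base, base_eq_affineEmb _ _ hp, first]

lemma point_base_of_eq (hp : p 0 = 0) : (ℓ.point Z c p).base = ℓ.ctr c := by
  rw [point_base, hp, zero_mul, add_zero, base_zero]

variable {ℓ c}

lemma first_mem_torus (hp : p 0 ≠ 0) (ho : c + p 0 * p 1 ≠ 0) : ℓ.first c p ∈ torus :=
  pt_mem_torus.2 ⟨hp, ho⟩

lemma coord_eq_zero_of_base_mem (ho : c + p 0 * p 1 ≠ 0) (h : (ℓ.point Z c p).base ∈ M.ctrs) :
    p 0 = 0 := by
  by_contra hp
  rw [point_base_of_ne Z ℓ c hp] at h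
  exact Model.affineEmb_notMem_ctrs (first_mem_torus hp ho) h

end Line

namespace BlowUp

lemma quadraticMap_ratMapAt (j : Fin 2) (p : Plane) : RatMapAt (quadraticMap j) p := by
  intro k
  fin_cases j <;> fin_cases k <;> simp [quadraticMap, Function.update] <;> fun_prop

lemma Chart.exists_base {Z : Set (ProjLine × ProjLine)} (i : Chart Z) :
    ∃ (z : ProjLine × ProjLine) (g : Plane → Plane), (∀ p, RatMapAt g p) ∧
      ∀ x : i.dom, (i.toPoint x).base = quadricChart z (g x) := by
  rcases i with z | ⟨z, hz, j⟩
  · exact ⟨z, fun x => x, fun p => RatMapAt.id, fun x => rfl⟩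
  · exact ⟨z, quadraticMap j, quadraticMap_ratMapAt j, fun x => rfl⟩

lemma mk_congr {Z : Set (ProjLine × ProjLine)} {b b' : ProjLine × ProjLine} (hb : b = b')
    {D D' : ℙ ℂ (Fin 2 → ℂ)} (hD : D = D') : (⟨b, fun _ => D⟩ : BlowUp Z) = ⟨b', fun _ => D'⟩ := by
  subst hb hD
  rfl

lemma quadraticMap_zero {j : Fin 2} {p : Plane} (h : p j = 0) : quadraticMap j p = 0 := by
  simp [quadraticMap, h]

lemma quadricChart_zero (z : ProjLine × ProjLine) : quadricChart z 0 = z := by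
  simp [quadricChart, ProjLine.chartAt_zero]

/-- A chart at a point whose image is in the torus factors through a first chart. -/
lemma Chart.exists_first_of_torus (i : Chart M.ctrs) (p : i.dom) {y : Plane} (hy : y ∈ torus)
    (h : (i.toPoint p).base = affineEmb y) (ℓ : Line) (c : ℂ) :
    ∃ g : Plane → Plane, RatMapAt g p ∧ c + g p 0 * g p 1 ≠ 0 ∧
      ∀ᶠ x in zNhds (p : Plane), ∀ hx, i.toPoint ⟨x, hx⟩ = ℓ.point _ c (g x) := by
  obtain ⟨z, q, hq, hb⟩ := i.exists_base
  rw [hb] at h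
  obtain ⟨Y₀, hY₀, hY₀'⟩ := ProjLine.chartAt_lift (hq p 0) (congrArg Prod.fst h)
  obtain ⟨Y₁, hY₁, hY₁'⟩ := ProjLine.chartAt_lift (hq p 1) (congrArg Prod.snd h)
  have hYb : ∀ᶠ x in zNhds (p : Plane), quadricChart z (q x) = affineEmb ![Y₀ x, Y₁ x] := by
    filter_upwards [hY₀', hY₁'] with x h0 h1
    exact Prod.ext h0 h1
  have hYp : ![Y₀ p, Y₁ p] = y := affineEmb_injective ((mem_of_mem_zNhds hYb).symm.trans h)
  have hYr : RatMapAt (fun x => ![Y₀ x, Y₁ x]) p := RatMapAt.mk hY₀ hY₁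
  have hYt : ∀ᶠ x in zNhds (p : Plane), ![Y₀ x, Y₁ x] ∈ torus := by
    filter_upwards [hY₀.eventually_ne (by rw [← hYp] at hy; exact hy.1),
      hY₁.eventually_ne (by rw [← hYp] at hy; exact hy.2)] with x h0 h1
    exact ⟨h0, h1⟩
  have hs : ∀ x ∈ torus, ℓ.firstInv c x ∈ (ℓ.firstEquiv c).source := fun x hx =>
    (ℓ.firstEquiv c).map_target hx
  refine ⟨fun x => ℓ.firstInv c ![Y₀ x, Y₁ x], RatMapAt.comp (f := ℓ.firstInv c)
    (g := fun x => ![Y₀ x, Y₁ x]) ?_ hYr, (hs _ (by rw [hYp]; exact hy)).2, ?_⟩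
  · exact (ℓ.isBirational_firstEquiv c).rat_symm _ (by rw [hYp]; exact hy)
  · filter_upwards [hYb, hYt] with x hxb hxt hx
    have hbase : (i.toPoint ⟨x, hx⟩).base = affineEmb ![Y₀ x, Y₁ x] := (hb ⟨x, hx⟩).trans hxb
    refine ext_of_base ?_ (by rw [hbase]; exact Model.affineEmb_notMem_ctrs hxt)
    rw [hbase, Line.point_base_of_ne _ _ _ (hs _ hxt).1]
    exact congrArg affineEmb ((ℓ.firstEquiv c).right_inv hxt).symm

/-- These directions have transversal component 1, so the slope `p 1` is an affine coordinate on the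
exceptional curve minus the direction of the line. -/
lemma mk_update_eq_iff {ℓ : Line} {p p' : Plane} :
    Projectivization.mk ℂ (Function.update (ℓ.conv p) ℓ.idx 1) (update_one_ne_zero _ _) =
      Projectivization.mk ℂ (Function.update (ℓ.conv p') ℓ.idx 1) (update_one_ne_zero _ _) ↔
      p 1 = p' 1 := by
  rw [Projectivization.mk_eq_mk_iff']
  constructor
  · rintro ⟨a, ha⟩
    have h0 := congrFun ha 0
    have h1 := congrFun ha 1
    cases ℓ <;> simp [Line.conv, Line.idx, swapCoord] at h0 h1 <;> simp_all
  · intro h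
    refine ⟨1, ?_⟩
    cases ℓ <;> refine plane_ext ?_ ?_ <;> simp [Line.conv, Line.idx, swapCoord, h]

/-- Two points of the first charts that agree: they are on the same exceptional curve, or in the
torus. -/
lemma point_eq_point {ℓ ℓ' : Line} {c c' : ℂ} {p p' : Plane} (hc : M.IsVal ℓ c)
    (hc' : M.IsVal ℓ' c') (ho : c + p 0 * p 1 ≠ 0) (ho' : c' + p' 0 * p' 1 ≠ 0)
    (h : ℓ.point M.ctrs c p = ℓ'.point M.ctrs c' p') :
    (ℓ = ℓ' ∧ c = c' ∧ p = p') ∨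
      (p 0 ≠ 0 ∧ p' 0 ≠ 0 ∧ ℓ.first c p = ℓ'.first c' p') := by
  by_cases hp : p 0 = 0
  · left
    have hb : (ℓ.point M.ctrs c p).base = ℓ.ctr c := Line.point_base_of_eq _ _ _ hp
    have hmem : (ℓ.point M.ctrs c p).base ∈ M.ctrs := ⟨ℓ, c, hc, hb⟩
    have hp' : p' 0 = 0 := Line.coord_eq_zero_of_base_mem _ ho' (h ▸ hmem)
    have hb' : (ℓ'.point M.ctrs c' p').base = ℓ'.ctr c' := Line.point_base_of_eq _ _ _ hp'
    obtain ⟨rfl, rfl⟩ := Line.ctr_inj hc'.ne_zero (hb.symm.trans (h ▸ hb'))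
    refine ⟨rfl, rfl, plane_ext (hp.trans hp'.symm) ?_⟩
    rw [Line.point, Line.point, BlowUp.mk.injEq] at h
    have hd := h.2
    have hq : quadricChart (ℓ.ctr c) (quadraticMap ℓ.idx (ℓ.conv p)) ∈ M.ctrs := hmem
    rw [h.1] at hd
    have := congrFun (eq_of_heq hd) (h.1 ▸ hq)
    exact mk_update_eq_iff.1 this
  · right
    have hb := Line.point_base_of_ne M.ctrs ℓ c hp
    have hp' : p' 0 ≠ 0 := by
      intro hp'
      refine Model.affineEmb_notMem_ctrs (M := M) (Line.first_mem_torus (ℓ := ℓ) hp ho) ?_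
      rw [← hb, h, Line.point_base_of_eq _ _ _ hp']
      exact ⟨ℓ', c', hc', rfl⟩
    refine ⟨hp, hp', affineEmb_injective ?_⟩
    rw [← hb, h, Line.point_base_of_ne M.ctrs ℓ' c' hp']

/-- A chart at a point in the image of a first chart factors through a first chart. -/
lemma Chart.exists_first (i : Chart M.ctrs) (p : i.dom) {ℓ : Line} {c : ℂ} {p' : Plane}
    (hc : M.IsVal ℓ c) (ho : c + p' 0 * p' 1 ≠ 0) (h : i.toPoint p = ℓ.point _ c p') :
    ∃ g : Plane → Plane, RatMapAt g p ∧ c + g p 0 * g p 1 ≠ 0 ∧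
      ∀ᶠ x in zNhds (p : Plane), ∀ hx, i.toPoint ⟨x, hx⟩ = ℓ.point _ c (g x) := by
  by_cases hp' : p' 0 = 0
  swap
  · refine i.exists_first_of_torus p (Line.first_mem_torus (ℓ := ℓ) hp' ho) ?_ ℓ c
    rw [h, Line.point_base_of_ne _ _ _ hp']
  have hb : (i.toPoint p).base = ℓ.ctr c := by rw [h, Line.point_base_of_eq _ _ _ hp']
  have hmem : ℓ.ctr c ∈ M.ctrs := ⟨ℓ, c, hc, rfl⟩
  rcases i with z | ⟨z, hz, j⟩
  · have hb' : quadricChart z p = ℓ.ctr c := hb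
    exact absurd (show quadricChart z p ∈ M.ctrs from hb' ▸ hmem) p.2
  have hpj : (p : Plane) j = 0 := by
    refine p.2.resolve_right fun hn => hn ?_
    have hb' : quadricChart z (quadraticMap j p) = ℓ.ctr c := hb
    exact hb' ▸ hmem
  have hz' : z = ℓ.ctr c := by
    rw [← hb]
    show z = quadricChart z (quadraticMap j p)
    rw [quadraticMap_zero hpj, quadricChart_zero]
  subst hz'
  by_cases hj : j = ℓ.idx
  · subst hj
    refine ⟨ℓ.conv, ℓ.ratMapAt_conv _, ?_, Eventually.of_forall fun x hx => ?_⟩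
    · have : ℓ.conv p 0 = 0 := by
        rw [← ℓ.conv_idx (ℓ.conv p), Line.conv_conv]
        exact hpj
      rw [this, zero_mul, add_zero]
      exact hc.ne_zero
    · exact mk_congr (by rw [Line.conv_conv]) (by simp only [Line.conv_conv])
  -- In the other quadratic chart, a zero coordinate here would mean the direction of the line,
  -- which no first chart contains.
  have hk : (p : Plane) ℓ.idx ≠ 0 := by
    rw [Chart.toPoint, Line.point, BlowUp.mk.injEq] at h
    have hd := h.2
    have hq : quadricChart (ℓ.ctr c) (quadraticMap j p) ∈ M.ctrs := by
      rw [quadraticMap_zero hpj, quadricChart_zero]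
      exact hmem
    rw [h.1] at hd
    have hd' := congrFun (eq_of_heq hd) (h.1 ▸ hq)
    rw [Projectivization.mk_eq_mk_iff'] at hd'
    obtain ⟨a, ha⟩ := hd'
    intro hk
    have h0 := congrFun ha j
    have h1 := congrFun ha ℓ.idx
    rw [Function.update_of_ne (Ne.symm hj), hk] at h1
    rw [Function.update_self] at h0
    simp only [Pi.smul_apply, Function.update_self, smul_eq_mul, mul_one] at h1
    rw [Pi.smul_apply, h1, zero_smul] at h0
    exact zero_ne_one h0
  -- The usual change of blow-up charts (u, v) ↦ (uv, 1/v).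
  refine ⟨fun x => ![x j * x ℓ.idx, (x ℓ.idx)⁻¹], RatMapAt.mk (by fun_prop)
    (by fun_prop (disch := assumption)), ?_, ?_⟩
  · simp [hpj, hc.ne_zero]
  · filter_upwards [(RatAt.coord ℓ.idx).eventually_ne hk] with x hx hxd
    have e1 : quadraticMap j x =
        quadraticMap ℓ.idx (ℓ.conv ![x j * x ℓ.idx, (x ℓ.idx)⁻¹]) := by
      cases ℓ <;> fin_cases j <;> simp [Line.idx] at hj hx <;> refine plane_ext ?_ ?_ <;>
        simp [Line.conv, Line.idx, quadraticMap, swapCoord] <;> field_simp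
    have e2 : Projectivization.mk ℂ (Function.update x j 1) (update_one_ne_zero _ _) =
        Projectivization.mk ℂ (Function.update (ℓ.conv ![x j * x ℓ.idx, (x ℓ.idx)⁻¹]) ℓ.idx 1)
          (update_one_ne_zero _ _) := by
      rw [Projectivization.mk_eq_mk_iff']
      refine ⟨x ℓ.idx, ?_⟩
      cases ℓ <;> fin_cases j <;> simp [Line.idx] at hj hx <;> refine plane_ext ?_ ?_ <;>
        simp [Line.conv, Line.idx, swapCoord, hx]
    exact mk_congr (congrArg _ e1) e2

end BlowUp

end

/-! ### The complement of the strict transforms and its cover by first charts -/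

noncomputable section

variable {M : Model}

/-- The complement of the strict transforms of the four lines. -/
def BlowUp.openSurface (Z : Set (ProjLine × ProjLine)) : Set (BlowUp Z) :=
  (BlowUp.strictTransform Z {x | x.1 = .some 0} ∪
    BlowUp.strictTransform Z {x | x.1 = ∞} ∪
    BlowUp.strictTransform Z {x | x.2 = .some 0} ∪
    BlowUp.strictTransform Z {x | x.2 = ∞})ᶜ

/-- The points of the line. -/
def Line.carrier : Line → Set (ProjLine × ProjLine)
  | .y0 => {x | x.1 = .some 0}
  | .yi => {x | x.1 = ∞}
  | .x0 => {x | x.2 = .some 0}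
  | .xi => {x | x.2 = ∞}

lemma Line.ctr_mem_carrier (ℓ : Line) (c : ℂ) : ℓ.ctr c ∈ ℓ.carrier := by
  cases ℓ <;> simp [ctr, carrier]

lemma Line.affineEmb_notMem_carrier (ℓ : Line) {x : Plane} (hx : x ∈ torus) :
    affineEmb x ∉ ℓ.carrier := by
  have h0 := hx.1
  have h1 := hx.2
  cases ℓ <;> simp [carrier, affineEmb, h0, h1]

lemma exists_affineEmb_or_mem_carrier (z : ProjLine × ProjLine) :
    (∃ x ∈ torus, z = affineEmb x) ∨ ∃ ℓ : Line, z ∈ ℓ.carrier := by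
  obtain ⟨a, b⟩ := z
  induction a using OnePoint.rec with
  | infty => exact Or.inr ⟨.yi, rfl⟩
  | coe a =>
    induction b using OnePoint.rec with
    | infty => exact Or.inr ⟨.xi, rfl⟩
    | coe b =>
      by_cases ha : a = 0
      · exact Or.inr ⟨.y0, by rw [ha]; rfl⟩
      by_cases hb : b = 0
      · exact Or.inr ⟨.x0, by rw [hb]; rfl⟩
      exact Or.inl ⟨![a, b], ⟨ha, hb⟩, rfl⟩

namespace BlowUp

lemma mem_openSurface_iff {Z : Set (ProjLine × ProjLine)} {x : BlowUp Z} :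
    x ∈ openSurface Z ↔ ∀ ℓ : Line, x ∉ strictTransform Z ℓ.carrier := by
  simp only [openSurface, Set.mem_compl_iff, Set.mem_union, not_or]
  constructor
  · rintro ⟨⟨⟨h1, h2⟩, h3⟩, h4⟩ (_ | _ | _ | _)
    exacts [h1, h2, h3, h4]
  · intro h
    exact ⟨⟨⟨h .y0, h .yi⟩, h .x0⟩, h .xi⟩

lemma isOpen_openSurface (Z : Set (ProjLine × ProjLine)) : IsOpen (openSurface Z) := by
  refine IsClosed.isOpen_compl (self := ?_)
  exact ((isClosed_closure.union isClosed_closure).union isClosed_closure).union isClosed_closure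

lemma ratAt_first_coord {c : ℂ} {g : Plane → Plane} {p : Plane} (hg : RatMapAt g p)
    (h : c + g p 0 * g p 1 ≠ 0) : ∀ᶠ x in zNhds p, c + g x 0 * g x 1 ≠ 0 := by
  have h0 := hg 0
  have h1 := hg 1
  exact RatAt.eventually_ne (f := fun x => c + g x 0 * g x 1) (by fun_prop) h

/-- The image of a first chart is open, and each of its points lies over the torus or over a centre.
It therefore misses the part of each line away from the centres, hence also the closure. -/
lemma point_mem_openSurface {ℓ : Line} {c : ℂ} {p : Plane} (hc : M.IsVal ℓ c)
    (ho : c + p 0 * p 1 ≠ 0) : ℓ.point M.ctrs c p ∈ openSurface M.ctrs := by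
  rw [mem_openSurface_iff]
  intro ℓ' h
  let O : Set (BlowUp M.ctrs) := {x | ∃ p : Plane, c + p 0 * p 1 ≠ 0 ∧ x = ℓ.point M.ctrs c p}
  have hO : IsOpen O := by
    refine isOpen_iff_eventually.2 fun i p hp => ?_
    obtain ⟨p', hp', h⟩ := hp
    obtain ⟨g, hg, hgp, h'⟩ := i.exists_first p hc hp' h
    filter_upwards [h', ratAt_first_coord hg hgp] with x hx hx' hxd
    exact ⟨g x, hx', hx hxd⟩
  obtain ⟨x, ⟨p', hp', rfl⟩, hx⟩ := mem_closure_iff.1 h O hO ⟨p, ho, rfl⟩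
  by_cases h0 : p' 0 = 0
  · refine hx.2 ?_
    rw [Line.point_base_of_eq _ _ _ h0]
    exact ⟨ℓ, c, hc, rfl⟩
  · refine ℓ'.affineEmb_notMem_carrier (Line.first_mem_torus (ℓ := ℓ) h0 hp') ?_
    rw [← Line.point_base_of_ne M.ctrs ℓ c h0]
    exact hx.1

lemma exists_point_of_base {Z : Set (ProjLine × ProjLine)} {z : BlowUp Z} (ℓ : Line) (c : ℂ)
    {x : Plane} (hx : x ∈ torus) (hz : z.base = affineEmb x) (hZ : z.base ∉ Z) :
    (ℓ.firstInv c x) 0 ≠ 0 ∧ c + ℓ.firstInv c x 0 * ℓ.firstInv c x 1 ≠ 0 ∧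
      z = ℓ.point Z c (ℓ.firstInv c x) := by
  have hs : ℓ.firstInv c x ∈ (ℓ.firstEquiv c).source := (ℓ.firstEquiv c).map_target hx
  refine ⟨hs.1, hs.2, ext_of_base ?_ hZ⟩
  rw [hz, Line.point_base_of_ne _ _ _ hs.1]
  exact congrArg affineEmb ((ℓ.firstEquiv c).right_inv hx).symm

/-- The direction of the line lies on its strict transform. -/
lemma mem_strictTransform_of_dir {ℓ : Line} {c : ℂ} (hc : M.IsVal ℓ c) {z : BlowUp M.ctrs}
    (hz : z.base = ℓ.ctr c) {v : Plane} (hv : v ≠ 0) (hv0 : v ℓ.idx = 0)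
    (hd : ∀ h, z.dir h = Projectivization.mk ℂ v hv) : z ∈ strictTransform M.ctrs ℓ.carrier := by
  obtain ⟨k, hk⟩ : ∃ k : Fin 2, k ≠ ℓ.idx := exists_ne _
  have hmem : ℓ.ctr c ∈ M.ctrs := ⟨ℓ, c, hc, rfl⟩
  let i : Chart M.ctrs := .over (ℓ.ctr c) hmem k
  have h0 : (0 : Plane) ∈ i.dom := Or.inl rfl
  have hzi : z = i.toPoint ⟨0, h0⟩ := by
    have e1 : quadricChart (ℓ.ctr c) (quadraticMap k 0) = ℓ.ctr c := by
      rw [quadraticMap_zero rfl, quadricChart_zero]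
    have e2 : Projectivization.mk ℂ v hv =
        Projectivization.mk ℂ (Function.update (0 : Plane) k 1) (update_one_ne_zero _ _) := by
      rw [Projectivization.mk_eq_mk_iff']
      refine ⟨v k, funext fun m => ?_⟩
      by_cases hm : m = k
      · subst hm
        simp
      · have : m = ℓ.idx := by
          revert hm hk
          generalize ℓ.idx = n
          fin_cases m <;> fin_cases k <;> fin_cases n <;> simp
        rw [Pi.smul_apply, Function.update_of_ne hm, this, hv0]
        simp
    obtain ⟨b, d⟩ := z
    have hd' : d = fun _ => Projectivization.mk ℂ v hv := funext hd
    rw [hd']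
    exact mk_congr (hz.trans e1.symm) e2
  rw [hzi]
  refine mem_closure_iff.2 fun o ho hzo => ?_
  have h1 := isOpen_iff_eventually.1 ho i ⟨0, h0⟩ hzo
  -- This moves along the strict transform: in the chart with index k, the axis through the origin
  -- maps to the line. The generic choice of `x 0` avoids the centres on that line.
  let g : Plane → Plane := fun x => Function.update 0 k (x 0)
  have hg : RatMapAt g 0 := by
    intro m
    by_cases hm : m = k
    · subst hm
      simpa [g] using RatAt.coord 0
    · simpa [g, Function.update_of_ne hm] using RatAt.const 0
  have hg0 : g 0 = 0 := by simp [g]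
  have h2 : ∀ᶠ x in zNhds 0, ∀ hx : g x ∈ i.dom, i.toPoint ⟨g x, hx⟩ ∈ o :=
    hg.tendsto.eventually (by rw [hg0]; exact h1)
  have h3 : ∀ᶠ x in zGen, ∀ hx : g x ∈ i.dom, i.toPoint ⟨g x, hx⟩ ∈ o := zGen_le_zNhds _ h2
  obtain ⟨x, hx1, hx3, hx4⟩ := nonempty_of_mem (inter_mem h3
    (inter_mem (mem_zGen_of_coord_ne 0 (M.e ℓ - c)) (mem_zGen_of_coord_ne 0 (M.f ℓ - c))))
  have hb : quadricChart (ℓ.ctr c) (quadraticMap k (g x)) = ℓ.ctr (c + x 0) := by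
    cases ℓ <;> fin_cases k <;> simp [Line.idx] at hk <;>
      simp [g, quadraticMap, quadricChart, Line.ctr, ProjLine.chartAt_some,
        ProjLine.chartAt_infty]
  have hb' : quadricChart (ℓ.ctr c) (quadraticMap k (g x)) ∉ M.ctrs := by
    rw [hb]
    rintro ⟨ℓ', c', hc', h⟩
    obtain ⟨rfl, h'⟩ := Line.ctr_inj hc'.ne_zero h
    rcases hc' with rfl | rfl
    · exact hx3 (eq_sub_of_add_eq' h')
    · exact hx4 (eq_sub_of_add_eq' h')
  refine ⟨i.toPoint ⟨g x, Or.inr hb'⟩, hx1 _, ?_, hb'⟩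
  show quadricChart (ℓ.ctr c) (quadraticMap k (g x)) ∈ ℓ.carrier
  rw [hb]
  exact ℓ.ctr_mem_carrier _

/-- The surface is covered by the first charts at the centres. -/
lemma exists_point {z : BlowUp M.ctrs} (hz : z ∈ openSurface M.ctrs) :
    ∃ ℓ c p, M.IsVal ℓ c ∧ c + p 0 * p 1 ≠ 0 ∧ z = ℓ.point M.ctrs c p := by
  rw [mem_openSurface_iff] at hz
  by_cases hZ : z.base ∈ M.ctrs
  · obtain ⟨ℓ, c, hc, hb⟩ := hZ
    have hmem : z.base ∈ M.ctrs := ⟨ℓ, c, hc, hb⟩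
    obtain ⟨v, hv, hd⟩ : ∃ (v : Plane) (hv : v ≠ 0), z.dir hmem = Projectivization.mk ℂ v hv := by
      induction h : z.dir hmem using Projectivization.ind with
      | h v hv => exact ⟨v, hv, rfl⟩
    by_cases hv0 : v ℓ.idx = 0
    · exact absurd (mem_strictTransform_of_dir hc hb hv hv0 fun _ => hd) (hz ℓ)
    · obtain ⟨k, hk⟩ : ∃ k : Fin 2, k ≠ ℓ.idx := exists_ne _
      -- A direction transversal to the line is the point of the exceptional curve whose coordinate
      -- is its slope.
      refine ⟨ℓ, c, ![0, v k / v ℓ.idx], hc, by simp [hc.ne_zero], ?_⟩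
      obtain ⟨b, d⟩ := z
      have hd' : d = fun _ => Projectivization.mk ℂ v hv := funext fun _ => hd
      rw [hd']
      refine mk_congr ?_ ?_
      · rw [← ℓ.base_zero] at hb
        have := ℓ.point_base M.ctrs c ![0, v k / v ℓ.idx]
        rw [Matrix.cons_val_zero, zero_mul, add_zero] at this
        exact hb.trans this.symm
      · rw [Projectivization.mk_eq_mk_iff']
        refine ⟨v ℓ.idx, ?_⟩
        cases ℓ <;> fin_cases k <;> simp [Line.idx] at hk hv0 <;> refine plane_ext ?_ ?_ <;>
          simp [Line.conv, Line.idx, swapCoord] <;> field_simp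
  · rcases exists_affineEmb_or_mem_carrier z.base with ⟨x, hx, hzx⟩ | ⟨ℓ, hℓ⟩
    · obtain ⟨-, h1, h2⟩ := exists_point_of_base .y0 (M.e .y0) hx hzx hZ
      exact ⟨.y0, _, _, Or.inl rfl, h1, h2⟩
    · exact absurd (subset_closure (show z ∈ base ⁻¹' (ℓ.carrier \ M.ctrs) from ⟨hℓ, hZ⟩)) (hz ℓ)

/-- Two rational maps to the surface that agree generically agree. -/
lemma point_eq_of_eventually {ℓ ℓ' : Line} {c c' : ℂ} {g g' : Plane → Plane} {p : Plane}
    (hc' : M.IsVal ℓ' c') (hg : RatMapAt g p) (hg' : RatMapAt g' p)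
    (ho : c + g p 0 * g p 1 ≠ 0) (ho' : c' + g' p 0 * g' p 1 ≠ 0)
    (h : ∀ᶠ x in zGen, ℓ.first c (g x) = ℓ'.first c' (g' x) ∧ ℓ.first c (g x) ∈ torus) :
    ℓ.point M.ctrs c (g p) = ℓ'.point M.ctrs c' (g' p) := by
  -- Separatedness of ℙ¹ × ℙ¹ gives equal images. If the common image is a centre, both maps use the
  -- same first chart and their coordinates agree by density; otherwise the image determines the
  -- point.
  have hbase : (ℓ.point M.ctrs c (g p)).base = (ℓ'.point M.ctrs c' (g' p)).base := by
    have h' : ∀ᶠ x in zGen, ℓ.base (g x 0) (c + g x 0 * g x 1) =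
        ℓ'.base (g' x 0) (c' + g' x 0 * g' x 1) := by
      refine h.mono fun x hx => ?_
      obtain ⟨h1, h2⟩ := hx
      have h3 : ℓ'.first c' (g' x) ∈ torus := h1 ▸ h2
      rw [ℓ.base_eq_affineEmb _ (Line.pt_mem_torus.1 h2).1,
        ℓ'.base_eq_affineEmb _ (Line.pt_mem_torus.1 h3).1]
      exact congrArg affineEmb h1
    have hr : ∀ (c : ℂ) (ℓ : Line) (g : Plane → Plane), RatMapAt g p →
        RatMapAt (fun x => ℓ.conv ![g x 0, c + g x 0 * g x 1]) p := by
      intro c ℓ g hg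
      have h0 := hg 0
      have h1 := hg 1
      exact (ℓ.ratMapAt_conv _).comp (g := fun x => ![g x 0, c + g x 0 * g x 1])
        (RatMapAt.mk (by fun_prop) (by fun_prop))
    rw [Line.point_base, Line.point_base]
    refine Prod.ext ?_ ?_
    · exact ProjLine.chartAt_eq_of_eventuallyEq (hr c ℓ g hg 0) (hr c' ℓ' g' hg' 0)
        (h'.mono fun x hx => congrArg Prod.fst hx)
    · exact ProjLine.chartAt_eq_of_eventuallyEq (hr c ℓ g hg 1) (hr c' ℓ' g' hg' 1)
        (h'.mono fun x hx => congrArg Prod.snd hx)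
  by_cases hZ : (ℓ.point M.ctrs c (g p)).base ∈ M.ctrs
  · have h0 := Line.coord_eq_zero_of_base_mem _ ho hZ
    have h0' := Line.coord_eq_zero_of_base_mem _ ho' (hbase ▸ hZ)
    rw [Line.point_base_of_eq _ _ _ h0, Line.point_base_of_eq _ _ _ h0'] at hbase
    obtain ⟨rfl, rfl⟩ := Line.ctr_inj hc'.ne_zero hbase
    have : g p = g' p := by
      refine hg.eq_of_eventuallyEq hg' (h.mono fun x hx => ?_)
      obtain ⟨h1, h2⟩ := hx
      have h3 : ℓ.first c (g' x) ∈ torus := h1 ▸ h2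
      exact (ℓ.firstEquiv c).injOn (Line.pt_mem_torus.1 h2) (Line.pt_mem_torus.1 h3) h1
    rw [this]
  · exact ext_of_base hbase hZ

end BlowUp

end

/-! ### From lifts in charts to an isomorphism of surfaces -/

noncomputable section

variable {M M' : Model} {e : PartialEquiv Plane Plane}

/-- The map `φ ∘ ρ` lifts at `p` to a regular map to a first chart of the surface. -/
def FirstLifts (M : Model) (φ : Plane → Plane) (S : Set Plane) (ρ : Plane → Plane) (p : Plane)
    (ℓ : Line) (c : ℂ) (g : Plane → Plane) : Prop :=
  M.IsVal ℓ c ∧ RatMapAt g p ∧ c + g p 0 * g p 1 ≠ 0 ∧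
    ∀ᶠ x in zNhds p, ρ x ∈ S → ℓ.first c (g x) = φ (ρ x)

lemma Lifts.exists_firstLifts {φ : Plane → Plane} {S : Set Plane} {ρ : Plane → Plane} {p : Plane}
    (hM : ∀ ℓ, M.e ℓ ≠ M.f ℓ) (h : Lifts M φ S ρ p) :
    ∃ ℓ c g, FirstLifts M φ S ρ p ℓ c g := by
  obtain ⟨ℓ, b, g, hg, hgp, h⟩ := h
  cases b with
  | false => exact ⟨ℓ, M.e ℓ, g, Or.inl rfl, hg, hgp, h⟩
  | true =>
    obtain ⟨c, hc, k, hk, hkp, h'⟩ := Model.second_cover (hM ℓ) hgp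
    refine ⟨ℓ, c, fun x => k (g x), hc, hk.comp hg, hkp, ?_⟩
    filter_upwards [h, hg.tendsto.eventually h'] with x hx hx' hS
    rw [← hx hS, hx', Line.first]

/-- The charts of a model treat the two centres asymmetrically, while the blow-up does not. With
distinct centres, the first chart at the second centre is reached by reversing the order. -/
lemma ModelIso.exists_firstLifts (h : ModelIso M M' e) (hM : ∀ ℓ, M.e ℓ ≠ M.f ℓ)
    (hM' : ∀ ℓ, M'.e ℓ ≠ M'.f ℓ) {ℓ : Line} {c : ℂ} {p : Plane} (hc : M.IsVal ℓ c)
    (ho : c + p 0 * p 1 ≠ 0) :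
    ∃ ℓ' c' g, FirstLifts M' e e.source (ℓ.first c) p ℓ' c' g := by
  refine Lifts.exists_firstLifts hM' ?_
  rcases hc with rfl | rfl
  · exact h.reg ℓ false p ho
  · have h1 : Lifts M (fun x => x) torus (ℓ.first (M.f ℓ)) p :=
      Lifts.of_first_swap (M := ⟨M.f, M.e, M.f_ne, M.e_ne⟩) (ℓ := ℓ) rfl rfl (hM ℓ).symm ho
    obtain ⟨ℓ', b', g, hg, hgp, h2⟩ := h1.trans h.reg
    exact ⟨ℓ', b', g, hg, hgp, h2.mono fun x hx hS => hx ⟨h.source_subset hS, hS⟩⟩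

/-- The relation between points of the surfaces given by the extension of `e`. -/
def PointRel (M M' : Model) (e : PartialEquiv Plane Plane) (z : BlowUp M.ctrs)
    (z' : BlowUp M'.ctrs) : Prop :=
  ∃ ℓ c p ℓ' c' g, M.IsVal ℓ c ∧ c + p 0 * p 1 ≠ 0 ∧ z = ℓ.point _ c p ∧
    FirstLifts M' e e.source (ℓ.first c) p ℓ' c' g ∧ z' = ℓ'.point _ c' (g p)

namespace ModelIso

open BlowUp

lemma exists_pointRel (h : ModelIso M M' e) (hM : ∀ ℓ, M.e ℓ ≠ M.f ℓ)
    (hM' : ∀ ℓ, M'.e ℓ ≠ M'.f ℓ) {z : BlowUp M.ctrs} (hz : z ∈ openSurface M.ctrs) :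
    ∃ z' ∈ openSurface M'.ctrs, PointRel M M' e z z' := by
  obtain ⟨ℓ, c, p, hc, ho, rfl⟩ := exists_point hz
  obtain ⟨ℓ', c', g, hg⟩ := h.exists_firstLifts hM hM' hc ho
  exact ⟨_, point_mem_openSurface hg.1 hg.2.2.1, ℓ, c, p, ℓ', c', g, hc, ho, rfl, hg, rfl⟩

lemma eventually_first_mem (h : ModelIso M M' e) (ℓ : Line) (c : ℂ) :
    ∀ᶠ x in zGen, ℓ.first c x ∈ e.source :=
  (ℓ.isBirational_firstEquiv c).tendsto h.birational.source_mem

/-- Two lifts at the same point both equal e generically, so they agree there by separatedness. -/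
lemma pointRel_unique (h : ModelIso M M' e) {z : BlowUp M.ctrs} {z₁ z₂ : BlowUp M'.ctrs}
    (h₁ : PointRel M M' e z z₁) (h₂ : PointRel M M' e z z₂) : z₁ = z₂ := by
  obtain ⟨ℓ, c, p, ℓ₁, c₁, g₁, hc, ho, rfl, ⟨hc₁, hg₁, ho₁, he₁⟩, rfl⟩ := h₁
  obtain ⟨ℓ', c', p', ℓ₂, c₂, g₂, hc', ho', hz, ⟨hc₂, hg₂, ho₂, he₂⟩, rfl⟩ := h₂
  rcases point_eq_point hc hc' ho ho' hz with ⟨rfl, rfl, rfl⟩ | ⟨h0, h0', heq⟩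
  · refine point_eq_of_eventually hc₂ hg₁ hg₂ ho₁ ho₂ ?_
    filter_upwards [zGen_le_zNhds _ he₁, zGen_le_zNhds _ he₂, h.eventually_first_mem ℓ c]
      with x h1 h2 h3
    rw [h1 h3, h2 h3]
    exact ⟨rfl, h.target_subset (e.map_source h3)⟩
  -- A torus point may be presented in two different charts; k is the transition map, through which
  -- both lifts are compared in the same coordinates.
  · set k : Plane → Plane := fun x => ℓ'.firstInv c' (ℓ.first c x) with hk
    have ht : ℓ.first c p ∈ torus := Line.first_mem_torus h0 ho
    have hkr : RatMapAt k p :=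
      RatMapAt.comp ((ℓ'.isBirational_firstEquiv c').rat_symm _ ht)
        ((ℓ.isBirational_firstEquiv c).rat p ⟨h0, ho⟩)
    have hkp : k p = p' := by
      rw [hk]
      simp only
      rw [heq]
      exact (ℓ'.firstEquiv c').left_inv ⟨h0', ho'⟩
    rw [← hkp] at hg₂ ho₂ he₂ ⊢
    refine point_eq_of_eventually hc₂ hg₁ (hg₂.comp hkr) ho₁ ho₂ ?_
    filter_upwards [zGen_le_zNhds _ he₁, zGen_le_zNhds _ (hkr.tendsto.eventually he₂),
      h.eventually_first_mem ℓ c] with x h1 h2 h3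
    have h4 : ℓ'.first c' (k x) = ℓ.first c x :=
      (ℓ'.firstEquiv c').right_inv (h.source_subset h3)
    rw [h4] at h2
    rw [h1 h3, h2 h3]
    exact ⟨rfl, h.target_subset (e.map_source h3)⟩

/-- Composing a lift of e with a lift of its inverse gives a rational map that is generically the
identity, hence the identity at the point considered. -/
lemma pointRel_symm_eq (h : ModelIso M M' e) (hM : ∀ ℓ, M.e ℓ ≠ M.f ℓ)
    (hM' : ∀ ℓ, M'.e ℓ ≠ M'.f ℓ) {z z₂ : BlowUp M.ctrs} {z₁ : BlowUp M'.ctrs}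
    (h₁ : PointRel M M' e z z₁) (h₂ : PointRel M' M e.symm z₁ z₂) : z₂ = z := by
  obtain ⟨ℓ, c, p, ℓ₁, c₁, g₁, hc, ho, rfl, ⟨hc₁, hg₁, ho₁, he₁⟩, rfl⟩ := h₁
  obtain ⟨ℓ₂, c₂, g₂, hc₂, hg₂, ho₂, he₂⟩ := h.symm.exists_firstLifts hM' hM hc₁ ho₁
  have h₃ : PointRel M' M e.symm (ℓ₁.point _ c₁ (g₁ p)) (ℓ₂.point _ c₂ (g₂ (g₁ p))) :=
    ⟨ℓ₁, c₁, g₁ p, ℓ₂, c₂, g₂, hc₁, ho₁, rfl, ⟨hc₂, hg₂, ho₂, he₂⟩, rfl⟩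
  rw [h.symm.pointRel_unique h₂ h₃]
  refine point_eq_of_eventually hc (hg₂.comp hg₁) RatMapAt.id ho₂ ho ?_
  filter_upwards [zGen_le_zNhds _ he₁, zGen_le_zNhds _ (hg₁.tendsto.eventually he₂),
    h.eventually_first_mem ℓ c] with x h1 h2 h3
  have h4 := e.map_source h3
  rw [h1 h3] at h2
  rw [h2 h4, e.left_inv h3]
  exact ⟨rfl, h.source_subset h3⟩

end ModelIso

lemma eventually_eventually_zNhds {p : Plane} {s : Plane → Prop} (h : ∀ᶠ x in zNhds p, s x) :
    ∀ᶠ x in zNhds p, ∀ᶠ y in zNhds x, s y := by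
  obtain ⟨G, hG, h⟩ := mem_zNhds.1 h
  exact mem_zNhds.2 ⟨G, hG, fun x hx => mem_zNhds.2 ⟨G, hx, h⟩⟩

lemma RatAt.eventually {f : Plane → ℂ} {p : Plane} (h : RatAt f p) :
    ∀ᶠ x in zNhds p, RatAt f x := by
  obtain ⟨F, G, hG, h⟩ := h
  exact mem_zNhds.2 ⟨G, hG, fun x hx => ⟨F, G, hx, h⟩⟩

lemma RatMapAt.eventually {g : Plane → Plane} {p : Plane} (h : RatMapAt g p) :
    ∀ᶠ x in zNhds p, RatMapAt g x := by
  filter_upwards [(h 0).eventually, (h 1).eventually] with x h0 h1 k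
  fin_cases k
  · exact h0
  · exact h1

namespace ModelIso

open BlowUp

lemma isRegularMap (h : ModelIso M M' e) (hM : ∀ ℓ, M.e ℓ ≠ M.f ℓ)
    (hM' : ∀ ℓ, M'.e ℓ ≠ M'.f ℓ) (f : openSurface M.ctrs → openSurface M'.ctrs)
    (hf : ∀ z : openSurface M.ctrs, PointRel M M' e z (f z)) : IsRegularMap f := by
  refine isRegularMap_of_charts (isOpen_openSurface _) f fun i p hp => ?_
  obtain ⟨ℓ, c, p', hc, ho, hpp⟩ := exists_point hp
  obtain ⟨g₀, hg₀, ho₀, h₀⟩ := i.exists_first p hc ho hpp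
  obtain ⟨ℓ', c', g, hc', hg, ho', hge⟩ := h.exists_firstLifts hM hM' hc ho₀
  refine ⟨.over (ℓ'.ctr c') ⟨ℓ', c', hc', rfl⟩ ℓ'.idx, fun x => ℓ'.conv (g (g₀ x)),
    (ℓ'.ratMapAt_conv _).comp (hg.comp hg₀), ?_⟩
  filter_upwards [h₀, ratAt_first_coord hg₀ ho₀,
    hg₀.tendsto.eventually (ratAt_first_coord hg ho'),
    hg₀.tendsto.eventually hg.eventually,
    hg₀.tendsto.eventually (eventually_eventually_zNhds hge)] with x h1 h2 h3 h4 h5 hx hxU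
  -- The lift chosen at p remains a lift at all nearby points, so by uniqueness it computes f there
  -- too, although f was defined pointwise by choice.
  have hrel : PointRel M M' e (i.toPoint ⟨x, hx⟩) (ℓ'.point _ c' (g (g₀ x))) :=
    ⟨ℓ, c, g₀ x, ℓ', c', g, hc, h2, h1 hx, ⟨hc', h4, h3, h5⟩, rfl⟩
  refine ⟨?_, h.pointRel_unique (hf ⟨_, hxU⟩) hrel⟩
  by_cases h0 : g (g₀ x) 0 = 0
  · exact Or.inl ((ℓ'.conv_idx _).trans h0)
  · refine Or.inr ?_
    have hb := Line.point_base_of_ne M'.ctrs ℓ' c' h0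
    show (ℓ'.point M'.ctrs c' (g (g₀ x))).base ∉ M'.ctrs
    rw [hb]
    exact Model.affineEmb_notMem_ctrs (Line.first_mem_torus h0 h3)

lemma exists_affineEmb (h : ModelIso M M' e) (f : openSurface M.ctrs → openSurface M'.ctrs)
    (hf : ∀ z : openSurface M.ctrs, PointRel M M' e z (f z)) {x : Plane} (hx : x ∈ e.source) :
    ∃ z : openSurface M.ctrs, (z : BlowUp M.ctrs).base = affineEmb x ∧
      (f z : BlowUp M'.ctrs).base = affineEmb (e x) := by
  have hs := (Line.y0.firstEquiv (M.e .y0)).map_target (h.source_subset hx)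
  have hsx := (Line.y0.firstEquiv (M.e .y0)).right_inv (h.source_subset hx)
  set p := (Line.y0.firstEquiv (M.e .y0)).symm x with hp
  have hsx' : Line.y0.first (M.e .y0) p = x := hsx
  have ht' := h.target_subset (e.map_source hx)
  have hs' := (Line.y0.firstEquiv (M'.e .y0)).map_target ht'
  have hsx'' := (Line.y0.firstEquiv (M'.e .y0)).right_inv ht'
  have hr : RatMapAt (Line.y0.first (M.e .y0)) p :=
    (Line.y0.isBirational_firstEquiv _).rat p hs
  have her : RatMapAt (fun x => e (Line.y0.first (M.e .y0) x)) p :=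
    RatMapAt.comp (by rw [hsx']; exact h.birational.rat x hx) hr
  let g : Plane → Plane := fun x =>
    (Line.y0.firstEquiv (M'.e .y0)).symm (e (Line.y0.first (M.e .y0) x))
  have hgp : g p = (Line.y0.firstEquiv (M'.e .y0)).symm (e x) := by
    show (Line.y0.firstEquiv (M'.e .y0)).symm (e (Line.y0.first (M.e .y0) p)) = _
    rw [hsx']
  have hrel : PointRel M M' e (Line.y0.point M.ctrs (M.e .y0) p)
      (Line.y0.point M'.ctrs (M'.e .y0) (g p)) := by
    refine ⟨.y0, _, p, .y0, _, g, Or.inl rfl, hs.2, rfl, ⟨Or.inl rfl, ?_, ?_, ?_⟩, rfl⟩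
    · refine RatMapAt.comp (f := (Line.y0.firstEquiv (M'.e .y0)).symm) ?_ her
      refine (Line.y0.isBirational_firstEquiv _).rat_symm _ ?_
      rw [hsx']
      exact ht'
    · rw [hgp]
      exact hs'.2
    · exact Eventually.of_forall fun y hy =>
        (Line.y0.firstEquiv (M'.e .y0)).right_inv (h.target_subset (e.map_source hy))
  have hmem := point_mem_openSurface (M := M) (ℓ := .y0) (Or.inl rfl) hs.2
  refine ⟨⟨_, hmem⟩, ?_, ?_⟩
  · rw [Line.point_base_of_ne _ _ _ hs.1, hsx']
  · rw [h.pointRel_unique (hf ⟨_, hmem⟩) hrel, hgp, Line.point_base_of_ne _ _ _ hs'.1]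
    exact congrArg affineEmb hsx''

/-- A birational transformation that lifts to the charts extends to an isomorphism of the
surfaces. -/
theorem exists_equiv (h : ModelIso M M' e) (hM : ∀ ℓ, M.e ℓ ≠ M.f ℓ)
    (hM' : ∀ ℓ, M'.e ℓ ≠ M'.f ℓ) :
    ∃ Φ : openSurface M.ctrs ≃ openSurface M'.ctrs, IsRegularMap Φ ∧ IsRegularMap Φ.symm ∧
      ∀ x ∈ e.source, ∃ z : openSurface M.ctrs, (z : BlowUp M.ctrs).base = affineEmb x ∧
        (Φ z : BlowUp M'.ctrs).base = affineEmb (e x) := by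
  choose f hf using fun z : openSurface M.ctrs => h.exists_pointRel hM hM' z.2
  choose k hk using fun z : openSurface M'.ctrs => h.symm.exists_pointRel hM' hM z.2
  let Φ : openSurface M.ctrs ≃ openSurface M'.ctrs :=
    { toFun := fun z => ⟨f z, (hf z).1⟩
      invFun := fun z => ⟨k z, (hk z).1⟩
      left_inv := fun z => Subtype.ext (h.pointRel_symm_eq hM hM' (hf z).2 (hk ⟨f z, (hf z).1⟩).2)
      right_inv := fun z => Subtype.ext (h.symm.pointRel_symm_eq hM' hM (hk z).2
        (hf ⟨k z, (hk z).1⟩).2) }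
  exact ⟨Φ, h.isRegularMap hM hM' Φ fun z => (hf z).2, h.symm.isRegularMap hM' hM Φ.symm
    fun z => (hk z).2, fun x hx => h.exists_affineEmb Φ (fun z => (hf z).2) hx⟩

end ModelIso

end

noncomputable section

/-! ### The map `φ` -/

section Translation

variable {q k₁ k₂ t₁ t₂ c₁ c₂ c₃ c₄ y x η y' x' a b : ℂ}

/-- The diagonal entries at `y'` of the transformed matrix. -/
lemma TranslationRel.diag_eq (hq : q ≠ 0) (hk₁ : k₁ ≠ 0) (hk₂ : k₂ ≠ 0) (ht₁ : t₁ ≠ 0)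
    (ht₂ : t₂ ≠ 0) (h₁ : c₁ ≠ 0) (h₂ : c₂ ≠ 0)
    (hrel : k₁ * k₂ * c₁ * c₂ * c₃ * c₄ = t₁ * t₂)
    (h : TranslationRel q (c₁ * c₂ / t₁) (c₁ * c₂ / t₂) (1 / k₁) (q / k₂) c₁ c₂ c₃ c₄ y x η y' x')
    (ha : a * y * x = (y - c₁) * (y - c₂) - k₁ * y ^ 2 * x - t₁ * x)
    (hb : b * y = k₁ * k₂ * x * (y - c₃) * (y - c₄) - k₂ * y ^ 2 - t₂) :
    x' * (t₂ + y' * (b + (k₂ - q * k₁) * y) + q * k₁ * y' ^ 2) = (y' - c₁) * (y' - c₂) ∧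
    k₂ * y' ^ 2 + (q * a - (k₂ - q * k₁) * y) * y' + q * t₁ =
      q * k₁ * k₂ * x' * (y' - c₃) * (y' - c₄) := by
  obtain ⟨hy, hx, hx8, hη3, hη4, -, hx'7, -, hη, hx', hy'⟩ := h
  obtain ⟨b₅, hb₅⟩ : ∃ b₅, b₅ = c₁ * c₂ / t₁ := ⟨_, rfl⟩
  obtain ⟨b₆, hb₆⟩ : ∃ b₆, b₆ = c₁ * c₂ / t₂ := ⟨_, rfl⟩
  obtain ⟨b₇, hb₇⟩ : ∃ b₇, b₇ = 1 / k₁ := ⟨_, rfl⟩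
  obtain ⟨b₈, hb₈⟩ : ∃ b₈, b₈ = q / k₂ := ⟨_, rfl⟩
  simp only [← hb₅, ← hb₆, ← hb₇, ← hb₈] at hx8 hx'7 hη hx' hy'
  have h5 : b₅ * t₁ = c₁ * c₂ := by rw [hb₅]; field_simp
  have h6 : b₆ * t₂ = c₁ * c₂ := by rw [hb₆]; field_simp
  have h7 : b₇ * k₁ = 1 := by rw [hb₇]; field_simp
  have h8 : b₈ * k₂ = q := by rw [hb₈]; field_simp
  have hb₈0 : b₈ ≠ 0 := by rw [hb₈]; exact div_ne_zero hq hk₂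
  have hb₆0 : b₆ ≠ 0 := by rw [hb₆]; exact div_ne_zero (mul_ne_zero h₁ h₂) ht₂
  have h52 : k₁ * k₂ * c₃ * c₄ * b₅ = t₂ := by
    apply mul_left_cancel₀ ht₁
    linear_combination hrel + k₁ * k₂ * c₃ * c₄ * h5
  have h61 : k₁ * k₂ * c₃ * c₄ * b₆ = t₁ := by
    apply mul_left_cancel₀ ht₂
    linear_combination hrel + k₁ * k₂ * c₃ * c₄ * h6
  have hη' : η * ((x - b₈) * y) = c₃ * c₄ * (x - b₅) := by
    rw [hη]
    field_simp
  -- With this ratio the zeros of the numerator of ξ' are c₂ρ and c₁ρ, and b₇/q = ρb₆.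
  obtain ⟨ρ, hρ⟩ : ∃ ρ, ρ = b₇ / (q * b₆) := ⟨_, rfl⟩
  have hρ1 : q * k₁ * b₆ * ρ = 1 := by
    rw [hρ]
    field_simp
    linear_combination h7
  have hρ2 : ρ * (q * b₆) = b₇ := by
    rw [hρ]
    field_simp
  have hd : c₃ * c₄ * b₅ = ρ * b₈ * (c₁ * c₂) := by
    apply mul_left_cancel₀ (mul_ne_zero hk₁ hk₂)
    apply mul_left_cancel₀ hb₆0
    linear_combination b₆ * h52 + h6 - k₁ * ρ * b₆ * c₁ * c₂ * h8 - c₁ * c₂ * hρ1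
  have hd₁ : c₃ * c₄ * b₅ / (b₈ * c₁) = c₂ * ρ := by
    rw [hd]
    field_simp
  have hd₂ : c₃ * c₄ * b₅ / (b₈ * c₂) = c₁ * ρ := by
    rw [hd]
    field_simp
  have hx'' : x' * x * ((η - c₃) * (η - c₄)) = b₆ * b₈ * ((η - c₂ * ρ) * (η - c₁ * ρ)) := by
    rw [hx', hd₁, hd₂]
    field_simp
  have hw : y' * (x' - b₇ / q) = η * (x' - b₆) := by
    rw [hy', div_mul_cancel₀ _ hx'7]
  have hqρ : b₇ / q = ρ * b₆ := by
    rw [← hρ2]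
    field_simp
  rw [hqρ] at hw hx'7
  constructor
  -- Let P(z) = q k₁ z² + (b + (k₂ - q k₁)y)z + t₂, so P(y) = A₂₂(y). Then y is a root of P(z) -
  -- k₁k₂x(z - c₃)(z - c₄), whose product of roots is ηy. `A0` is the sum of the roots, and `A1`
  -- says that η is the other root.
  · have A0 : k₁ * k₂ * (b₈ - x) * η + b + (k₂ - q * k₁) * y + k₁ * k₂ * x * (c₃ + c₄) -
        k₁ * k₂ * (x - b₈) * y = 0 := by
      apply (mul_eq_zero_iff_left hy).1
      linear_combination (-k₁ * k₂) * hη' + hb + h52 + k₁ * y ^ 2 * h8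
    have A1 : q * k₁ * η ^ 2 + η * (b + (k₂ - q * k₁) * y) + t₂ =
        k₁ * k₂ * x * ((η - c₃) * (η - c₄)) := by
      linear_combination η * A0 + k₁ * k₂ * hη' - h52 - k₁ * η ^ 2 * h8
    have A2 : x' * (q * k₁ * η ^ 2 + η * (b + (k₂ - q * k₁) * y) + t₂) =
        q * k₁ * b₆ * η ^ 2 - (c₁ + c₂) * η + c₁ * c₂ * ρ := by
      linear_combination x' * A1 + k₁ * k₂ * hx'' + k₁ * b₆ * (η - c₂ * ρ) * (η - c₁ * ρ) * h8 +
        (c₁ * c₂ * ρ - (c₁ + c₂) * η) * hρ1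
    -- `A2` is a quadratic equation for η whose outer coefficients are q k₁(x' - b₆) and t₂(x' -
    -- ρb₆). Scaling the root by (x' - b₆)/(x' - ρb₆), which turns η into y', exchanges these two
    -- factors and yields x'P(z) = (z - c₁)(z - c₂) at z = y'.
    have A3 : (x' - ρ * b₆) * (x' * (t₂ + y' * (b + (k₂ - q * k₁) * y) + q * k₁ * y' ^ 2) -
        (y' - c₁) * (y' - c₂)) = 0 := by
      linear_combination (x' - b₆) * (A2 - ρ * h6) + (q * k₁ * (y' * (x' - ρ * b₆) +
        η * (x' - b₆)) + (b + (k₂ - q * k₁) * y) * x' + c₁ + c₂) * hw +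
        (x' - ρ * b₆) * y' ^ 2 * hρ1 + (x' - ρ * b₆) * h6
    exact sub_eq_zero.1 ((mul_eq_zero_iff_left hx'7).1 A3)
  -- The same argument with Q(z) = k₂z² + (qa - (k₂ - q k₁)y)z + q t₁, for which Q(y) = q A₁₁(y).
  -- The roots of xQ(z) - q(z - c₁)(z - c₂) are y and η/ρ, and `B0` is their sum.
  · have B0 : q * k₁ * k₂ * b₆ * (x - b₈) * η + q * (c₁ + c₂) +
        x * (q * a - (k₂ - q * k₁) * y) + k₂ * (x - b₈) * y = 0 := by
      apply (mul_eq_zero_iff_left hy).1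
      linear_combination q * k₁ * k₂ * b₆ * hη' + q * ha + q * (x - b₅) * h61 - q * h5 -
        y ^ 2 * h8
    have B1 : -(q * k₁ * k₂ * x' * ((η - c₃) * (η - c₄))) + q * k₁ * k₂ * b₆ * η ^ 2 +
        η * (q * a - (k₂ - q * k₁) * y) + k₂ * c₃ * c₄ = 0 := by
      apply (mul_eq_zero_iff_left hx).1
      linear_combination η * B0 - q * k₁ * k₂ * hx'' + k₂ * b₈ * ((c₁ + c₂) * η - c₁ * c₂ * ρ) * hρ1
        + (c₁ + c₂) * η * h8 + k₂ * hd - k₂ * hη'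
    have B2 : (x' - ρ * b₆) * (k₂ * y' ^ 2 + (q * a - (k₂ - q * k₁) * y) * y' + q * t₁ -
        q * k₁ * k₂ * x' * (y' - c₃) * (y' - c₄)) = 0 := by
      linear_combination (x' - b₆) * B1 + (-(q * k₁ * k₂ * (y' * (x' - ρ * b₆) +
        η * (x' - b₆))) + (q * a - (k₂ - q * k₁) * y) + q * k₁ * k₂ * x' * (c₃ + c₄)) * hw -
        k₂ * y' ^ 2 * (x' - ρ * b₆) * hρ1 - q * (x' - ρ * b₆) * h61 +
        (x' - b₆) * k₂ * c₃ * c₄ * hρ1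
    exact sub_eq_zero.1 ((mul_eq_zero_iff_left hx'7).1 B2)

end Translation

end

/-! ### Bringing Â to Jimbo–Sakai normal form -/

noncomputable section

section Conjugation

open Polynomial Matrix

variable {q k₁ k₂ t₁ t₂ c₁ c₂ c₃ c₄ y x w x' a b β γ : ℂ}

/-- The matrix with given Jimbo–Sakai coordinates. -/
lemma isJimboSakai_of_coord (hy : y ≠ 0) (hx : x ≠ 0)
    (hrel : k₁ * k₂ * c₁ * c₂ * c₃ * c₄ = t₁ * t₂)
    (ha : a * y * x = (y - c₁) * (y - c₂) - k₁ * y ^ 2 * x - t₁ * x)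
    (hb : b * y = k₁ * k₂ * x * (y - c₃) * (y - c₄) - k₂ * y ^ 2 - t₂)
    (hγ : γ = k₁ * b + k₂ * a + k₁ * k₂ * (c₁ + c₂ + c₃ + c₄))
    (hβ : β = a * b + k₁ * t₂ + k₂ * t₁ + y * γ -
      k₁ * k₂ * (c₁ * c₂ + c₁ * c₃ + c₁ * c₄ + c₂ * c₃ + c₂ * c₄ + c₃ * c₄)) :
    IsJimboSakai ⟨k₁, k₂, t₁, t₂, c₁, c₂, c₃, c₄⟩
      !![C k₁ * X ^ 2 + C a * X + C t₁, X - C y;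
        X * (C γ * X + C β), C k₂ * X ^ 2 + C b * X + C t₂] y x where
  y_ne_zero := hy
  ξ_ne_zero := hx
  normal_form := ⟨a, b, β, γ, rfl⟩
  det_eq := by
    -- γ and β were chosen to match the coefficients of z³ and z², and the constant term is the
    -- parameter relation. The remaining coefficient follows from the value at z = y, where the
    -- off-diagonal product vanishes and the determinant is A₁₁(y)A₂₂(y).
    have h₁ : y * β = -(a * t₂) - b * t₁ -
        k₁ * k₂ * (c₁ * c₂ * c₃ + c₁ * c₂ * c₄ + c₁ * c₃ * c₄ + c₂ * c₃ * c₄) := by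
      apply mul_left_cancel₀ hy
      apply mul_left_cancel₀ hx
      linear_combination x * y ^ 2 * hβ + x * y ^ 3 * hγ + x * hrel +
        (k₂ * y ^ 2 + b * y + t₂) * ha + (y - c₁) * (y - c₂) * hb
    rw [det_fin_two_of]
    have h₁' := congrArg (C : ℂ → ℂ[X]) h₁
    have hβ' := congrArg (C : ℂ → ℂ[X]) hβ
    have hγ' := congrArg (C : ℂ → ℂ[X]) hγ
    have hr' := congrArg (C : ℂ → ℂ[X]) hrel
    simp only [map_mul, map_add, map_sub, map_neg] at h₁' hβ' hγ' hr' ⊢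
    linear_combination X * h₁' - X ^ 2 * hβ' - X ^ 3 * hγ' - hr'
  ξ_eq₁ := by
    simp
    linear_combination ha
  ξ_eq₂ := by
    simp
    linear_combination hb

/-- The diagonal entries at w alone suffice: they have the right product q det A(w), and this pins
down w as the zero of the new upper right entry. The nonvanishing hypothesis `hD` makes the
conjugating matrix invertible. -/
lemma isPhi_of_diag_eq {p p' : Plane} (hp0 : p 0 = y) (hp1 : p 1 = x) (hp'0 : p' 0 = w)
    (hp'1 : p' 1 = x') (hq : q ≠ 0) (hy : y ≠ 0) (hx : x ≠ 0) (hw : w ≠ 0) (hx' : x' ≠ 0)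
    (hwy : w ≠ y) (hrel : k₁ * k₂ * c₁ * c₂ * c₃ * c₄ = t₁ * t₂)
    (ha : a * y * x = (y - c₁) * (y - c₂) - k₁ * y ^ 2 * x - t₁ * x)
    (hb : b * y = k₁ * k₂ * x * (y - c₃) * (y - c₄) - k₂ * y ^ 2 - t₂)
    (hD : (k₂ - q * k₁) ^ 2 * y + k₂ * b + q ^ 2 * k₁ * a +
      q * k₁ * k₂ * (c₁ + c₂ + c₃ + c₄) ≠ 0)
    (h₁₁ : x' * (t₂ + w * (b + (k₂ - q * k₁) * y) + q * k₁ * w ^ 2) = (w - c₁) * (w - c₂))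
    (h₂₂ : k₂ * w ^ 2 + (q * a - (k₂ - q * k₁) * y) * w + q * t₁ =
      q * k₁ * k₂ * x' * (w - c₃) * (w - c₄)) :
    IsPhi ⟨k₁, k₂, t₁, t₂, c₁, c₂, c₃, c₄⟩ q p p' := by
  obtain ⟨γ, hγ⟩ : ∃ γ, γ = k₁ * b + k₂ * a + k₁ * k₂ * (c₁ + c₂ + c₃ + c₄) := ⟨_, rfl⟩
  obtain ⟨β, hβ⟩ : ∃ β, β = a * b + k₁ * t₂ + k₂ * t₁ + y * γ -
      k₁ * k₂ * (c₁ * c₂ + c₁ * c₃ + c₁ * c₄ + c₂ * c₃ + c₂ * c₄ + c₃ * c₄) := ⟨_, rfl⟩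
  have hA := isJimboSakai_of_coord hy hx hrel ha hb hγ hβ
  have hdet := hA.det_eq
  have hdetw := congrArg (eval w) hdet
  rw [det_fin_two_of] at hdetw
  simp only [eval_sub, eval_mul, eval_add, eval_C, eval_pow, eval_X] at hdetw
  obtain ⟨k, hk⟩ : ∃ k, k = k₂ - q * k₁ := ⟨_, rfl⟩
  obtain ⟨m, hm⟩ : ∃ m, m = q * t₁ - t₂ := ⟨_, rfl⟩
  rw [← hk] at hD h₁₁ h₂₂
  -- The two diagonal values are A₂₂ - kz(z - y) and q A₁₁ + kz(z - y) at z = w. Their product minus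
  -- q det A is z(z - y) times a polynomial of degree at most one, because the quadratic terms
  -- cancel; its vanishing at w is the claim.
  have hDw : (k ^ 2 * y + q * γ + k * b - k * q * a) * w = k * m - q * β := by
    have : w * (w - y) * ((k ^ 2 * y + q * γ + k * b - k * q * a) * w - (k * m - q * β)) = 0 := by
      subst hk hm
      linear_combination (-q) * hdetw + k₁ * k₂ * q * (w - c₃) * (w - c₄) * h₁₁ +
        (t₂ + w * (b + (k₂ - q * k₁) * y) + q * k₁ * w ^ 2) * h₂₂
    exact sub_eq_zero.1 ((mul_eq_zero_iff_left (mul_ne_zero hw (sub_ne_zero.2 hwy))).1 this)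
  have hΔ : k * m - q * β ≠ 0 := by
    rw [← hDw]
    refine mul_ne_zero (fun h => hD ?_) hw
    rw [← h, hγ, hk]
    ring
  let Ah : Matrix (Fin 2) (Fin 2) ℂ[X] :=
    !![C q * (C k₁ * X ^ 2 + C a * X + C t₁), C q * X * (X - C y);
      C γ * X + C β, C k₂ * X ^ 2 + C b * X + C t₂]
  obtain ⟨l, hl⟩ : ∃ l, l = k / q := ⟨_, rfl⟩
  have el : q * l = k := by rw [hl]; field_simp
  -- The normal form is upper triangular at z = 0 and has lower triangular leading coefficient. So
  -- the first column is an eigenvector of Â(0) for q t₁, and the second one, a multiple of (q, k),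
  -- an eigenvector of the leading coefficient for k₂; the factor -w makes the upper right entry
  -- monic.
  let V : Matrix (Fin 2) (Fin 2) ℂ := !![m, -w; β, -(l * w)]
  obtain ⟨a', ha'⟩ : ∃ a', a' = b + k * y - m / w := ⟨_, rfl⟩
  obtain ⟨b', hb'⟩ : ∃ b', b' = q * a - k * y + m / w := ⟨_, rfl⟩
  obtain ⟨γ', hγ'⟩ : ∃ γ', γ' = -(q * β / w) := ⟨_, rfl⟩
  obtain ⟨β', hβ'⟩ : ∃ β', β' = (m * a' - q * a * m + q * y * β) / w := ⟨_, rfl⟩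
  have ea : w * a' = w * (b + k * y) - m := by rw [ha']; field_simp
  have eb : w * b' = w * (q * a - k * y) + m := by rw [hb']; field_simp
  have eγ : w * γ' = -(q * β) := by rw [hγ']; field_simp
  have eβ : w * β' = m * a' - q * a * m + q * y * β := by rw [hβ']; field_simp
  have hV : V.det ≠ 0 := by
    have : V.det = -(w * (k * m - q * β) / q) := by
      simp only [V, det_fin_two_of, hl]
      field_simp
      ring
    rw [this]
    exact neg_ne_zero.2 (div_ne_zero (mul_ne_zero hw hΔ) hq)
  let M : Matrix (Fin 2) (Fin 2) ℂ[X] :=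
    !![C (q * k₁) * X ^ 2 + C a' * X + C (q * t₁), X - C w;
      X * (C γ' * X + C β'), C k₂ * X ^ 2 + C b' * X + C t₂]
  have hAV : Ah * V.map C = V.map C * M := by
    have e₁ : k₂ * β = β * (q * k₁) - l * w * γ' := by
      linear_combination l * eγ - β * el - β * hk
    have e₂ : γ * m + b * β = β * a' - l * w * β' := by
      apply mul_left_cancel₀ (mul_ne_zero hq hw)
      linear_combination m * hDw + (k * m - q * β) * ea + k * w * eβ + w ^ 2 * β' * el
    have e₃ : w * γ + l * w * b = l * w * b' - β := by
      apply mul_left_cancel₀ hq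
      linear_combination hDw - k * eb + (w * b - w * b') * el
    have E := congrArg (C : ℂ → ℂ[X]) eβ
    have E₀ := congrArg (C : ℂ → ℂ[X]) eγ
    have E₁ := congrArg (C : ℂ → ℂ[X]) e₁
    have E₂ := congrArg (C : ℂ → ℂ[X]) e₂
    have E₃ := congrArg (C : ℂ → ℂ[X]) e₃
    have E₄ := congrArg (C : ℂ → ℂ[X]) eb
    have E₅ := congrArg (C : ℂ → ℂ[X]) el
    have E₆ := congrArg (C : ℂ → ℂ[X]) hk
    have E₇ := congrArg (C : ℂ → ℂ[X]) hm
    simp only [map_mul, map_add, map_sub, map_neg] at E E₀ E₁ E₂ E₃ E₄ E₅ E₆ E₇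
    ext1 i j
    fin_cases i <;> fin_cases j <;> simp [Ah, M, V, Matrix.mul_apply, Fin.sum_univ_two]
    · linear_combination X ^ 2 * E₀ + X * E
    · linear_combination X * E₄ - C w * X * (X - C y) * E₅ - C w * X ^ 2 * E₆ + C w * E₇
    · linear_combination X ^ 2 * E₁ + X * E₂ + C β * E₇
    · linear_combination -X * E₃
  let U := GeneralLinearGroup.mkOfDetNeZero V hV
  have hU : (U : Matrix (Fin 2) (Fin 2) ℂ) = V := rfl
  have hM : ((U⁻¹ : (Matrix (Fin 2) (Fin 2) ℂ)ˣ) : Matrix (Fin 2) (Fin 2) ℂ).map C * Ah *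
      (U : Matrix (Fin 2) (Fin 2) ℂ).map C = M := by
    rw [hU, mul_assoc, hAV, ← mul_assoc, ← hU, ← Matrix.map_mul, Units.inv_mul]
    simp
  have hdetM : M.det = C q * (C (k₁ * k₂) *
      ((X - C c₁) * (X - C c₂) * (X - C c₃) * (X - C c₄))) := by
    have h := congrArg det hAV
    rw [det_mul, det_mul, mul_comm] at h
    have hVC : (V.map C).det ≠ 0 := by
      have : (V.map C).det = C V.det := ((C : ℂ →+* ℂ[X]).map_det V).symm
      rw [this]
      exact C_ne_zero.2 hV
    rw [← mul_left_cancel₀ hVC h, ← hdet, det_fin_two_of, det_fin_two_of]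
    ring
  refine ⟨_, Ah, U⁻¹, by rw [hp0, hp1]; exact hA, ?_, ?_⟩
  · simp only [Ah]
    rw [mul_fin_two, mul_fin_two]
    ext1 i j
    fin_cases i <;> fin_cases j <;> simp <;> ring
  · rw [inv_inv, hM, hp'0, hp'1]
    refine ⟨hw, hx', ⟨a', b', β', γ', rfl⟩, ?_, ?_, ?_⟩
    · rw [hdetM]
      simp only [Params.shift, map_mul]
      ring
    · simp [M, Params.shift]
      linear_combination h₁₁ + x' * ea - x' * hm
    · simp [M, Params.shift]
      linear_combination h₂₂ + eb + hm

end Conjugation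

end

/-! ### Genericity, and the proof of the theorem -/

noncomputable section

lemma mem_zGen_of_eval_ne {f : Plane → ℂ} (hf : RatAt f 0) (h0 : f 0 ≠ 0) : {x | f x ≠ 0} ∈ zGen :=
  zGen_le_zNhds 0 (hf.eventually_ne h0)

section Generic

variable {q k₁ k₂ t₁ t₂ c₁ c₂ c₃ c₄ : ℂ} {e : PartialEquiv Plane Plane}

lemma eventually_isPhi (hq : q ≠ 0) (hk₁ : k₁ ≠ 0) (hk₂ : k₂ ≠ 0) (ht₁ : t₁ ≠ 0)
    (ht₂ : t₂ ≠ 0) (h₁ : c₁ ≠ 0) (h₂ : c₂ ≠ 0) (h₃ : c₃ ≠ 0) (h₄ : c₄ ≠ 0)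
    (hrel : k₁ * k₂ * c₁ * c₂ * c₃ * c₄ = t₁ * t₂) (hes : e.source ∈ zGen)
    (he : ∀ x ∈ e.source, ∃ η, TranslationRel q (c₁ * c₂ / t₁) (c₁ * c₂ / t₂) (1 / k₁) (q / k₂)
      c₁ c₂ c₃ c₄ (x 0) (x 1) η (e x 0) (e x 1)) :
    ∀ᶠ x in zGen, IsPhi ⟨k₁, k₂, t₁, t₂, c₁, c₂, c₃, c₄⟩ q x (e x) := by
  -- The quantity `hD` of `isPhi_of_diag_eq`, multiplied by yξ with a and b eliminated. It is not
  -- identically zero, as its value at the origin is q²k₁c₁c₂.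
  have hD := mem_zGen_of_eval_ne (f := fun p => (k₂ - q * k₁) ^ 2 * (p 0 * p 0) * p 1 +
    k₂ * p 1 * (k₁ * k₂ * p 1 * (p 0 - c₃) * (p 0 - c₄) - k₂ * p 0 ^ 2 - t₂) +
    q ^ 2 * k₁ * ((p 0 - c₁) * (p 0 - c₂) - k₁ * p 0 ^ 2 * p 1 - t₁ * p 1) +
    q * k₁ * k₂ * (c₁ + c₂ + c₃ + c₄) * p 0 * p 1) (by fun_prop)
    (by simp [hq, hk₁, h₁, h₂])
  -- This excludes y' = y: in that case P(y) = A₂₂(y) expresses ξ' through (y, ξ), and eliminating η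
  -- gives the vanishing of this polynomial. At the origin its value is c₃c₄(c₁c₂)²/t₁.
  have hH := mem_zGen_of_eval_ne (f := fun p => p 0 ^ 2 * (p 1 - q / k₂) *
      ((p 0 - c₁) * (p 0 - c₂) - 1 / k₁ / q * (k₁ * k₂ * p 1 * (p 0 - c₃) * (p 0 - c₄))) -
    c₃ * c₄ * (p 1 - c₁ * c₂ / t₁) * ((p 0 - c₁) * (p 0 - c₂) -
      c₁ * c₂ / t₂ * (k₁ * k₂ * p 1 * (p 0 - c₃) * (p 0 - c₄)))) (by fun_prop)
    (by simp [h₁, h₂, h₃, h₄, ht₁])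
  filter_upwards [hes, hD, hH] with p hp hDp hHp
  obtain ⟨η, h⟩ := he p hp
  generalize hy : p 0 = y at h hDp hHp
  generalize hx : p 1 = x at h hDp hHp
  generalize hw : e p 0 = w at h
  generalize hx' : e p 1 = x' at h
  have hy0 := h.y_ne
  have hx0 := h.ξ_ne
  obtain ⟨b, hb⟩ : ∃ b, b = (k₁ * k₂ * x * (y - c₃) * (y - c₄) - k₂ * y ^ 2 - t₂) / y := ⟨_, rfl⟩
  obtain ⟨a, ha⟩ : ∃ a, a = ((y - c₁) * (y - c₂) - k₁ * y ^ 2 * x - t₁ * x) / (y * x) := ⟨_, rfl⟩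
  replace hb : b * y = k₁ * k₂ * x * (y - c₃) * (y - c₄) - k₂ * y ^ 2 - t₂ := by
    rw [hb, div_mul_cancel₀ _ hy0]
  replace ha : a * y * x = (y - c₁) * (y - c₂) - k₁ * y ^ 2 * x - t₁ * x := by
    rw [ha, mul_assoc, div_mul_cancel₀ _ (mul_ne_zero hy0 hx0)]
  obtain ⟨hA, hB⟩ := h.diag_eq hq hk₁ hk₂ ht₁ ht₂ h₁ h₂ hrel ha hb
  refine isPhi_of_diag_eq hy hx hw hx' hq hy0 hx0 h.y'_ne h.ξ'_ne ?_ hrel ha hb ?_ hA hB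
  · rintro rfl
    apply hHp
    have e₁ : w * (x' - 1 / k₁ / q) = η * (x' - c₁ * c₂ / t₂) := by
      nth_rw 1 [h.y'_eq]
      rw [div_mul_cancel₀ _ h.ξ'_ne₇]
    have e₂ : η * ((x - q / k₂) * w) = c₃ * c₄ * (x - c₁ * c₂ / t₁) := by
      rw [h.η_eq, div_mul_cancel₀ _ (mul_ne_zero h.ξ_ne₈ hy0)]
    have e₃ : x' * (k₁ * k₂ * x * (w - c₃) * (w - c₄)) = (w - c₁) * (w - c₂) := by
      linear_combination hA - x' * hb
    rw [← e₃]
    linear_combination (k₁ * k₂ * x * (w - c₃) * (w - c₄)) *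
      (w * (x - q / k₂) * e₁ + (x' - c₁ * c₂ / t₂) * e₂)
  · intro h0
    apply hDp
    linear_combination y * x * h0 - k₂ * x * hb - q ^ 2 * k₁ * ha

end Generic

lemma Params.exists_equiv (P : Params) (q : ℂ) {M M' : Model} {e : PartialEquiv Plane Plane}
    (h : ModelIso M M' e) (hM : ∀ ℓ, M.e ℓ ≠ M.f ℓ) (hM' : ∀ ℓ, M'.e ℓ ≠ M'.f ℓ)
    (hP : P.centres q = M.ctrs) (hP' : (P.shift q).centres q = M'.ctrs)
    (he : ∀ᶠ x in zGen, IsPhi P q x (e x)) :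
    ∃ Φ : P.surface q ≃ (P.shift q).surface q,
      BlowUp.IsRegularMap Φ ∧ BlowUp.IsRegularMap Φ.symm ∧ ExtendsPhi P q Φ := by
  -- The type of the blow-up depends on the set of centres, so the equalities of sets are
  -- substituted for variable sets Z and Z'.
  have key : ∀ Z Z' : Set (ProjLine × ProjLine), Z = M.ctrs → Z' = M'.ctrs →
      ∃ Φ : BlowUp.openSurface Z ≃ BlowUp.openSurface Z',
        BlowUp.IsRegularMap Φ ∧ BlowUp.IsRegularMap Φ.symm ∧
        ∀ x ∈ e.source, ∃ z : BlowUp.openSurface Z, (z : BlowUp Z).base = affineEmb x ∧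
          (Φ z : BlowUp Z').base = affineEmb (e x) := by
    rintro _ _ rfl rfl
    exact h.exists_equiv hM hM'
  obtain ⟨Φ, h₁, h₂, h₃⟩ := key _ _ hP hP'
  refine ⟨Φ, h₁, h₂, ?_⟩
  obtain ⟨G, hG, hGe⟩ := mem_zGen.1 (inter_mem h.birational.source_mem he)
  refine ⟨{x | MvPolynomial.eval x G ≠ 0}, fun p hp => ⟨G, hp, fun x hx => hx⟩, ?_, fun p hp => ?_⟩
  · exact (show ∀ᶠ x in zGen, MvPolynomial.eval x G ≠ 0 from ⟨G, hG, fun x hx => hx⟩).exists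
  · exact ⟨e p, (hGe p hp).2, h₃ p (hGe p hp).1⟩

lemma Model.ctrs_of {a₁ a₂ b₁ b₂ c₁ c₂ d₁ d₂ : ℂ} (ha₁ : a₁ ≠ 0) (ha₂ : a₂ ≠ 0) (hb₁ : b₁ ≠ 0)
    (hb₂ : b₂ ≠ 0) (hc₁ : c₁ ≠ 0) (hc₂ : c₂ ≠ 0) (hd₁ : d₁ ≠ 0) (hd₂ : d₂ ≠ 0) :
    (Model.of a₁ a₂ b₁ b₂ c₁ c₂ d₁ d₂ ha₁ ha₂ hb₁ hb₂ hc₁ hc₂ hd₁ hd₂).ctrs =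
      {(.some c₁, .some 0), (.some c₂, .some 0), (.some d₁, ∞), (.some d₂, ∞),
        (.some 0, .some a₁), (.some 0, .some a₂), (∞, .some b₁), (∞, .some b₂)} := by
  ext z
  constructor
  · rintro ⟨_ | _ | _ | _, c, rfl | rfl, rfl⟩ <;> simp [Line.ctr]
  · rintro (rfl | rfl | rfl | rfl | rfl | rfl | rfl | rfl)
    exacts [⟨.x0, _, .inl rfl, rfl⟩, ⟨.x0, _, .inr rfl, rfl⟩, ⟨.xi, _, .inl rfl, rfl⟩,
      ⟨.xi, _, .inr rfl, rfl⟩, ⟨.y0, _, .inl rfl, rfl⟩, ⟨.y0, _, .inr rfl, rfl⟩,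
      ⟨.yi, _, .inl rfl, rfl⟩, ⟨.yi, _, .inr rfl, rfl⟩]

end

/-- The birational map `φ` extends to a regular isomorphism from the surface with parameters
`(κ₁, κ₂, θ₁, θ₂)` to the surface with parameters `(q κ₁, κ₂, q θ₁, θ₂)`. -/
theorem mainTheorem3 (P : Params) (q : ℂ) (hq : q ≠ 0)
    (hκ₁ : P.κ₁ ≠ 0) (hκ₂ : P.κ₂ ≠ 0) (hθ₁ : P.θ₁ ≠ 0) (hθ₂ : P.θ₂ ≠ 0)
    (hrel : P.κ₁ * P.κ₂ * P.c₁ * P.c₂ * P.c₃ * P.c₄ = P.θ₁ * P.θ₂)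
    (hc₁₂ : P.c₁ ≠ P.c₂) (hc₃₄ : P.c₃ ≠ P.c₄)
    (hθ : P.θ₁ ≠ P.θ₂) (hqθ : q * P.θ₁ ≠ P.θ₂)
    (hqκ : q * P.κ₁ ≠ P.κ₂) (hqqκ : q ^ 2 * P.κ₁ ≠ P.κ₂) :
    ∃ Φ : P.surface q ≃ (P.shift q).surface q,
      BlowUp.IsRegularMap Φ ∧ BlowUp.IsRegularMap Φ.symm ∧ ExtendsPhi P q Φ := by
  -- The cᵢ are nonzero because their product with κ₁κ₂ is θ₁θ₂.
  have hne : P.κ₁ * P.κ₂ * P.c₁ * P.c₂ * P.c₃ * P.c₄ ≠ 0 := hrel ▸ mul_ne_zero hθ₁ hθ₂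
  simp only [mul_ne_zero_iff] at hne
  obtain ⟨⟨⟨⟨-, h₁⟩, h₂⟩, h₃⟩, h₄⟩ := hne
  have h12 : P.c₁ * P.c₂ ≠ 0 := mul_ne_zero h₁ h₂
  obtain ⟨e, he, hφ⟩ := exists_modelIso hq (div_ne_zero h12 hθ₁) (div_ne_zero h12 hθ₂)
    (one_div_ne_zero hκ₁) (div_ne_zero hq hκ₂) h₁ h₂ h₃ h₄ (by
      field_simp
      linear_combination hrel)
  refine P.exists_equiv q he ?_ ?_ ?_ ?_
    (eventually_isPhi hq hκ₁ hκ₂ hθ₁ hθ₂ h₁ h₂ h₃ h₄ hrel he.birational.source_mem hφ)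
  -- Distinct centres on the source: θ₁ ≠ θ₂ on y = 0, qκ₁ ≠ κ₂ on y = ∞.
  · rintro (_ | _ | _ | _)
    · simpa [Model.of, div_eq_mul_inv, h₁, h₂] using hθ
    · intro h
      simp only [Model.of] at h
      field_simp at h
      exact hqκ h
    · exact hc₁₂
    · exact hc₃₄
  -- Distinct centres on the target: qθ₁ ≠ θ₂ on y = 0, q²κ₁ ≠ κ₂ on y = ∞.
  · rintro (_ | _ | _ | _)
    · intro h
      simp only [Model.of] at h
      field_simp at h
      exact hqθ (by rw [mul_comm, h])
    · intro h
      simp only [Model.of] at h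
      field_simp at h
      exact hqqκ (by rw [h, mul_comm])
    · exact hc₁₂
    · exact hc₃₄
  · rw [Model.ctrs_of, Params.centres, Set.pair_comm (∞, _)]
  · have e₁ : P.c₁ * P.c₂ / (q * P.θ₁) = P.c₁ * P.c₂ / P.θ₁ / q := by field_simp
    have e₂ : 1 / (q * P.κ₁) = 1 / P.κ₁ / q := by field_simp
    simp only [Model.ctrs_of, Params.centres, Params.shift, e₁, e₂]
    rw [Set.insert_comm (OnePoint.some 0, OnePoint.some (P.c₁ * P.c₂ / P.θ₁ / q))]
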